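/- **Definitions.** A generalized quadrangle is a point-line geometry $\Gamma$ that contains no ordinary $2$-gon or $3$-gon, in which any two elements (points or lines) lie in an ordinary $4$-gon (an apartment), and which contains an ordinary $5$-gon; it has order $(s,t)$ if every line has $s+1$ points and every point is on $t+1$ lines. For a set $A$ of points, $A^{\perp}$ is the set of points collinear with every point of $A$ (a point being collinear with itself). A triple $(\Gamma,x,E)$ is a finite skew translation generalized quadrangle (STGQ) if $\Gamma$ is a finite generalized quadrangle of some order $(s,t)$, $x$ is a point, $E$ is a group of automorphisms of $\Gamma$ fixing every line on $x$ and acting sharply transitively on the points not collinear with $x$, and $x$ is regular, i.e. $|\{x,y\}^{\perp\perp}|=t+1$ for every point $y$ not collinear with $x$. It has property $(*)$ if every line $Y$ on $x$ is incident with a point $y\neq x$ whose stabilizer $E_y$ is a normal subgroup of $E$. A symmetry with center $x$ is an automorphism of $\Gamma$ that fixes every point collinear with $x$. A root is a sequence $(a,p,M,q,b)$ of five different elements of an apartment, consecutive ones incident, where $a,M,b$ are lines and $p,q$ are points; its interior $(p,M,q)$ is called an i-root. An i-root $(p,M,q)$ is Moufang if, for every root $(a,p,M,q,b)$ with this interior,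 the group of all automorphisms of $\Gamma$ that fix every line on $p$, every line on $q$ and every point on $M$ acts transitively on the apartments containing the root. **Theorem.** Let $(\Gamma,x,E)$ be a finite STGQ that has property $(*)$ and whose order is not of the form $(t,t)$ with $t$ even. Then: 1. (property (C)) the group of all symmetries with center $x$ is a subgroup of the center of $E$; 2. every i-root containing $x$ (that is, every i-root $(p,M,q)$ with $x\in\{p,q\}$) is Moufang. -/

import Mathlib

/-- A point-line incidence geometry with point set `P` and line set `L`. -/
structure PointLineGeometry (P L : Type*) where
  /-- `Inc p l` : the point `p` is incident with the line `l`. -/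
  Inc : P → L → Prop

namespace PointLineGeometry

/-- The cyclic sequence `p 0, l 0, p 1, l 1, …, p (k-1), l (k-1)` is an ordinary `k`-gon:
its `k` points are distinct, its `k` lines are distinct, consecutive elements are incident. -/
def IsOrdinaryGon {P L : Type*} (Γ : PointLineGeometry P L) (k : ℕ) [NeZero k]
    (p : Fin k → P) (l : Fin k → L) : Prop :=
  Function.Injective p ∧ Function.Injective l ∧
    ∀ i : Fin k, Γ.Inc (p i) (l i) ∧ Γ.Inc (p (i + 1)) (l i)

/-- The set of elements (points and lines) of a cyclic sequence as above. -/
def gonElements {P L : Type*} {k : ℕ} (p : Fin k → P) (l : Fin k → L) : Set (P ⊕ L) :=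
  Set.range (fun i => Sum.inl (p i)) ∪ Set.range (fun i => Sum.inr (l i))

/-- An apartment: the element set of an ordinary `4`-gon. -/
def IsApartment {P L : Type*} (Γ : PointLineGeometry P L) (A : Set (P ⊕ L)) : Prop :=
  ∃ (p : Fin 4 → P) (l : Fin 4 → L), Γ.IsOrdinaryGon 4 p l ∧ A = gonElements p l

/-- (Thick) generalized quadrangles. -/
structure IsGeneralizedQuadrangle {P L : Type*} (Γ : PointLineGeometry P L) : Prop where
  no_two_gon : ∀ (p : Fin 2 → P) (l : Fin 2 → L), ¬ Γ.IsOrdinaryGon 2 p l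
  no_three_gon : ∀ (p : Fin 3 → P) (l : Fin 3 → L), ¬ Γ.IsOrdinaryGon 3 p l
  exists_apartment : ∀ u v : P ⊕ L, ∃ A : Set (P ⊕ L), Γ.IsApartment A ∧ u ∈ A ∧ v ∈ A
  exists_five_gon : ∃ (p : Fin 5 → P) (l : Fin 5 → L), Γ.IsOrdinaryGon 5 p l

/-- The points incident with a line. -/
def pointsOn {P L : Type*} (Γ : PointLineGeometry P L) (l : L) : Set P := {p | Γ.Inc p l}

/-- The lines incident with a point. -/
def linesOn {P L : Type*} (Γ : PointLineGeometry P L) (p : P) : Set L := {l | Γ.Inc p l}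

/-- The geometry has order `(s, t)`. -/
def HasOrder {P L : Type*} (Γ : PointLineGeometry P L) (s t : ℕ) : Prop :=
  (∀ l : L, (Γ.pointsOn l).ncard = s + 1) ∧ ∀ p : P, (Γ.linesOn p).ncard = t + 1

/-- Two (possibly equal) points are collinear. -/
def Collinear {P L : Type*} (Γ : PointLineGeometry P L) (p q : P) : Prop :=
  ∃ l : L, Γ.Inc p l ∧ Γ.Inc q l

/-- `A^⊥` : the points collinear with every point of `A`. -/
def perp {P L : Type*} (Γ : PointLineGeometry P L) (A : Set P) : Set P :=
  {z | ∀ a ∈ A, Γ.Collinear z a}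

/-- The point `x` (of a finite generalized quadrangle of order `(s, t)`) is regular:
`{x, y}^⊥⊥` has `t + 1` points for each point `y` not collinear with `x`.
Here `t + 1` is written as the number of lines on `x`. -/
def IsRegularPoint {P L : Type*} (Γ : PointLineGeometry P L) (x : P) : Prop :=
  ∀ y : P, ¬ Γ.Collinear x y → (Γ.perp (Γ.perp {x, y})).ncard = (Γ.linesOn x).ncard

/-- The automorphism group: pairs of a permutation of the points and a permutation of the
lines which together preserve incidence. -/
def autGroup {P L : Type*} (Γ : PointLineGeometry P L) :
    Subgroup (Equiv.Perm P × Equiv.Perm L) where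
  carrier := {g | ∀ p l, Γ.Inc (g.1 p) (g.2 l) ↔ Γ.Inc p l}
  mul_mem' := by
    intro a b ha hb p l
    exact (ha (b.1 p) (b.2 l)).trans (hb p l)
  one_mem' := by
    intro p l
    exact Iff.rfl
  inv_mem' := by
    intro a ha p l
    have h := ha (a.1⁻¹ p) (a.2⁻¹ l)
    simpa using h.symm

/-- The subgroup of the automorphism group that fixes every line incident with a point of `D`
and every point incident with a line of `D`. -/
def fixator {P L : Type*} (Γ : PointLineGeometry P L) (D : Set (P ⊕ L)) :
    Subgroup (Equiv.Perm P × Equiv.Perm L) where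
  carrier := {g | g ∈ Γ.autGroup ∧
    (∀ p, Sum.inl p ∈ D → ∀ l, Γ.Inc p l → g.2 l = l) ∧
    (∀ l, Sum.inr l ∈ D → ∀ p, Γ.Inc p l → g.1 p = p)}
  mul_mem' := by
    rintro a b ⟨ha, ha1, ha2⟩ ⟨hb, hb1, hb2⟩
    refine ⟨mul_mem ha hb, fun p hp l h => ?_, fun l hl p h => ?_⟩
    · rw [Prod.snd_mul, Equiv.Perm.mul_apply, hb1 p hp l h, ha1 p hp l h]
    · rw [Prod.fst_mul, Equiv.Perm.mul_apply, hb2 l hl p h, ha2 l hl p h]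
  one_mem' := ⟨one_mem _, fun _ _ _ _ => rfl, fun _ _ _ _ => rfl⟩
  inv_mem' := by
    rintro a ⟨ha, ha1, ha2⟩
    refine ⟨inv_mem ha, fun p hp l h => ?_, fun l hl p h => ?_⟩
    · rw [Prod.snd_inv, Equiv.Perm.inv_eq_iff_eq, ha1 p hp l h]
    · rw [Prod.fst_inv, Equiv.Perm.inv_eq_iff_eq, ha2 l hl p h]

/-- The group of symmetries with center `x`: the automorphisms that fix every point collinear
with `x`. -/
def symmetryGroup {P L : Type*} (Γ : PointLineGeometry P L) (x : P) :
    Subgroup (Equiv.Perm P × Equiv.Perm L) where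
  carrier := {g | g ∈ Γ.autGroup ∧ ∀ y, Γ.Collinear x y → g.1 y = y}
  mul_mem' := by
    rintro a b ⟨ha, ha1⟩ ⟨hb, hb1⟩
    refine ⟨mul_mem ha hb, fun y h => ?_⟩
    rw [Prod.fst_mul, Equiv.Perm.mul_apply, hb1 y h, ha1 y h]
  one_mem' := ⟨one_mem _, fun _ _ => rfl⟩
  inv_mem' := by
    rintro a ⟨ha, ha1⟩
    refine ⟨inv_mem ha, fun y h => ?_⟩
    rw [Prod.fst_inv, Equiv.Perm.inv_eq_iff_eq, ha1 y h]

/-- `E` is an elation group with elation point `x`: a group of automorphisms that fixes every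
line on `x` and acts sharply transitively on the points not collinear with `x`. -/
structure IsElationGroup {P L : Type*} (Γ : PointLineGeometry P L) (x : P)
    (E : Subgroup (Equiv.Perm P × Equiv.Perm L)) : Prop where
  le_autGroup : E ≤ Γ.autGroup
  fixes_lines : ∀ g ∈ E, ∀ l : L, Γ.Inc x l → g.2 l = l
  sharply_transitive : ∀ y z : P, ¬ Γ.Collinear x y → ¬ Γ.Collinear x z →
    ∃! g : Equiv.Perm P × Equiv.Perm L, g ∈ E ∧ g.1 y = z

/-- `(Γ, x, E)` is a (finite) skew translation generalized quadrangle. -/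
structure IsSTGQ {P L : Type*} (Γ : PointLineGeometry P L) (x : P)
    (E : Subgroup (Equiv.Perm P × Equiv.Perm L)) : Prop where
  isGQ : Γ.IsGeneralizedQuadrangle
  isElationGroup : Γ.IsElationGroup x E
  isRegularPoint : Γ.IsRegularPoint x

/-- The stabilizer `E_y` of the point `y` in `E`, as a subgroup of `E`. -/
def pointStabilizer {P L : Type*} (E : Subgroup (Equiv.Perm P × Equiv.Perm L)) (y : P) :
    Subgroup E where
  carrier := {g | (g : Equiv.Perm P × Equiv.Perm L).1 y = y}
  mul_mem' := by
    intro a b ha hb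
    simp only [Set.mem_ofPred_eq] at ha hb
    simp only [Set.mem_ofPred_eq, Subgroup.coe_mul, Prod.fst_mul, Equiv.Perm.mul_apply, hb, ha]
  one_mem' := rfl
  inv_mem' := by
    intro a ha
    simp only [Set.mem_ofPred_eq] at ha
    simp only [Set.mem_ofPred_eq, Subgroup.coe_inv, Prod.fst_inv]
    rw [Equiv.Perm.inv_eq_iff_eq, ha]

/-- Property (*) at a line `Y` on `x`. -/
def StarAt {P L : Type*} (Γ : PointLineGeometry P L) (x : P)
    (E : Subgroup (Equiv.Perm P × Equiv.Perm L)) (Y : L) : Prop :=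
  ∃ y : P, Γ.Inc y Y ∧ y ≠ x ∧ (pointStabilizer E y).Normal

/-- Property (*): it holds at every line on `x`. -/
def HasStar {P L : Type*} (Γ : PointLineGeometry P L) (x : P)
    (E : Subgroup (Equiv.Perm P × Equiv.Perm L)) : Prop :=
  ∀ Y : L, Γ.Inc x Y → Γ.StarAt x E Y

/-- Property (C): the group of symmetries with center `x` is a subgroup of the center of `E`. -/
def HasCentrality {P L : Type*} (Γ : PointLineGeometry P L) (x : P)
    (E : Subgroup (Equiv.Perm P × Equiv.Perm L)) : Prop :=
  Γ.symmetryGroup x ≤ (Subgroup.center E).map E.subtype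

/-- The elements of the sequence `a, p, M, q, b` (line, point, line, point, line). -/
def rootElements {P L : Type*} (a : L) (p : P) (M : L) (q : P) (b : L) : Set (P ⊕ L) :=
  {Sum.inr a, Sum.inl p, Sum.inr M, Sum.inl q, Sum.inr b}

/-- `a, p, M, q, b` is a root with extremal lines `a` and `b`: five different elements of
some apartment, consecutive ones being incident. -/
def IsRoot {P L : Type*} (Γ : PointLineGeometry P L) (a : L) (p : P) (M : L) (q : P) (b : L) :
    Prop :=
  (a ≠ M ∧ M ≠ b ∧ a ≠ b ∧ p ≠ q) ∧
    (Γ.Inc p a ∧ Γ.Inc p M ∧ Γ.Inc q M ∧ Γ.Inc q b) ∧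
    ∃ A : Set (P ⊕ L), Γ.IsApartment A ∧ rootElements a p M q b ⊆ A

/-- `p, M, q` is an i-root: the interior of a root. -/
def IsIRoot {P L : Type*} (Γ : PointLineGeometry P L) (p : P) (M : L) (q : P) : Prop :=
  ∃ a b : L, Γ.IsRoot a p M q b

/-- The root `a, p, M, q, b` is Moufang: the automorphisms fixing all lines on `p`, all lines
on `q` and all points on `M` act transitively on the apartments containing the root. -/
def IsMoufangRoot {P L : Type*} (Γ : PointLineGeometry P L)
    (a : L) (p : P) (M : L) (q : P) (b : L) : Prop :=
  ∀ A A' : Set (P ⊕ L), Γ.IsApartment A → Γ.IsApartment A' →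
    rootElements a p M q b ⊆ A → rootElements a p M q b ⊆ A' →
    ∃ g ∈ Γ.fixator {Sum.inl p, Sum.inr M, Sum.inl q}, Sum.map g.1 g.2 '' A = A'

/-- The i-root `p, M, q` is Moufang: every root with this interior is Moufang. -/
def IsMoufangIRoot {P L : Type*} (Γ : PointLineGeometry P L) (p : P) (M : L) (q : P) : Prop :=
  ∀ a b : L, Γ.IsRoot a p M q b → Γ.IsMoufangRoot a p M q b

end PointLineGeometry

/-! Fix a point `y` not collinear with `x`. A line `M` on `y` meets a unique line `Y` on `x`; let
`A_M` be the stabilizer of `M` in `E`, `A*_Y` the group of elements fixing `Y` pointwise, and `S`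
the group of symmetries in `E`. Since `E` moves any point of `Y` other than `x` to any other, one
normal point stabilizer makes all of them equal, so (*) makes `A*_Y` a normal subgroup containing
`A_M`. Regularity of `x` gives that `A*_Y` and `A*_Z` meet in `S` for `Y ≠ Z`. It follows that
`|A_M| = s`, `|S| = t`, `|E| = s²t`, that `A*_Y = A_M S`, that `E/S` is abelian, and that each `A_M`
is abelian because it meets `S` trivially.

The decisive step is `exists_conj_eq`: for `k ≠ 1` in `A_M`, the whole coset `kS` consists of
conjugates of `k`. If `kσ` were not conjugate into `A_M`, its flag count in Benson's congruence
(`benson`) would force `s + t` to divide `st`. Counting elements of order dividing a prime `p ∣ s`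
in `A_M` shows that a power of `p` which is at least `t` divides `s`; with this, `not_add_dvd_mul`
excludes the divisibility unless `s = t` is even, which is the excluded case.

The same count and the conjugacy show that `s` and `t` are powers of one prime, so `E` is nilpotent.
Conjugacy also says that every element of `S` is a commutator with any given nontrivial element of
`A_M`. A character argument (`Subgroup.le_center_of_forall_exists_commutator`) then makes `S`
central. Every symmetry with center `x` lies in `E` by a rigidity argument, which gives (C).

For the Moufang condition on `(x, M, q)` and a line `b ≠ M` on `q`, the stabilizer of `b` fixes `M`
pointwise and is transitive on the points of `b` other than `q`, hence on the apartments containing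
the root. The lines on `q` other than `M` are the images of `b` under `S`, so centrality of `S`
makes this stabilizer fix all of them. -/

namespace PointLineGeometry

/-! ### Self-dual axioms and the existence of an order -/

/-- The first-order axioms of a weak generalized quadrangle, in a self-dual form. -/
structure IsQuad {P L : Type*} (Γ : PointLineGeometry P L) : Prop where
  line_unique : ∀ {p q : P} {l m : L}, p ≠ q → Γ.Inc p l → Γ.Inc q l → Γ.Inc p m →
    Γ.Inc q m → l = m
  triangle : ∀ {a b c : P} {l m n : L}, Γ.Inc a l → Γ.Inc b l → Γ.Inc b m → Γ.Inc c m →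
    Γ.Inc c n → Γ.Inc a n → a ≠ b → b ≠ c → a ≠ c → l = m
  exists_proj : ∀ {p : P} {l : L}, ¬ Γ.Inc p l → ∃ (q : P) (m : L),
    Γ.Inc p m ∧ Γ.Inc q m ∧ Γ.Inc q l
  exists_point_ne : ∀ (p : P) (l : L), ∃ q, q ≠ p ∧ Γ.Inc q l
  exists_line_ne : ∀ (l : L) (p : P), ∃ m, m ≠ l ∧ Γ.Inc p m

/-- The dual geometry. -/
def dual {P L : Type*} (Γ : PointLineGeometry P L) : PointLineGeometry L P where
  Inc l p := Γ.Inc p l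

lemma IsQuad.dual {P L : Type*} {Γ : PointLineGeometry P L} (h : Γ.IsQuad) : Γ.dual.IsQuad where
  line_unique := by
    intro p q l m hpq h1 h2 h3 h4
    by_contra hlm
    exact hpq (h.line_unique hlm h1 h3 h2 h4)
  triangle := by
    intro a b c l m n h1 h2 h3 h4 h5 h6 hab hbc hac
    by_contra hlm
    have hln : l ≠ n := by
      rintro rfl
      exact hbc (h.line_unique hlm h2 h3 h5 h4)
    have hmn : m ≠ n := by
      rintro rfl
      exact hab (h.line_unique hlm h1 h6 h2 h3)
    exact hab (h.triangle h6 h1 h2 h3 h4 h5 hln.symm hlm hmn.symm)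
  exists_proj := by
    intro p l hpl
    obtain ⟨q, m, h1, h2, h3⟩ := h.exists_proj hpl
    exact ⟨m, q, h3, h2, h1⟩
  exists_point_ne := h.exists_line_ne
  exists_line_ne := h.exists_point_ne

lemma IsOrdinaryGon.dual {P L : Type*} {Γ : PointLineGeometry P L} {p : Fin 5 → P}
    {l : Fin 5 → L} (h : Γ.IsOrdinaryGon 5 p l) :
    Γ.dual.IsOrdinaryGon 5 l (fun i => p (i + 1)) :=
  ⟨h.2.1, fun _ _ hij => add_right_cancel (h.1 hij), fun i => ⟨(h.2.2 i).2, (h.2.2 (i + 1)).1⟩⟩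

lemma IsGeneralizedQuadrangle.line_unique {P L : Type*} {Γ : PointLineGeometry P L}
    (h : Γ.IsGeneralizedQuadrangle) {p q : P} {l m : L} (hpq : p ≠ q) (h1 : Γ.Inc p l)
    (h2 : Γ.Inc q l) (h3 : Γ.Inc p m) (h4 : Γ.Inc q m) : l = m := by
  by_contra hlm
  refine h.no_two_gon ![p, q] ![l, m] ⟨?_, ?_, ?_⟩
  · intro i j; fin_cases i <;> fin_cases j <;> simp [hpq, hpq.symm]
  · intro i j; fin_cases i <;> fin_cases j <;> simp [hlm, Ne.symm hlm]
  · intro i; fin_cases i <;> simp [*]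

lemma IsGeneralizedQuadrangle.isQuad {P L : Type*} {Γ : PointLineGeometry P L}
    (h : Γ.IsGeneralizedQuadrangle) : Γ.IsQuad where
  line_unique := h.line_unique
  triangle := by
    intro a b c l m n h1 h2 h3 h4 h5 h6 hab hbc hac
    by_contra hlm
    have hln : l ≠ n := by
      rintro rfl
      exact hlm (h.line_unique hbc h2 h5 h3 h4)
    have hmn : m ≠ n := by
      rintro rfl
      exact hlm (h.line_unique hab h1 h2 h6 h3)
    refine h.no_three_gon ![a, b, c] ![l, m, n] ⟨?_, ?_, ?_⟩
    · intro i j; fin_cases i <;> fin_cases j <;>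
        simp [hab, hbc, hac, hab.symm, hbc.symm, hac.symm]
    · intro i j; fin_cases i <;> fin_cases j <;>
        simp [hlm, hln, hmn, Ne.symm hlm, hln.symm, hmn.symm]
    · intro i; fin_cases i <;> simp [*]
  exists_proj := by
    intro p l hpl
    obtain ⟨A, ⟨P', L', ⟨-, -, hinc⟩, rfl⟩, hp, hl⟩ := h.exists_apartment (Sum.inl p) (Sum.inr l)
    simp only [gonElements, Set.mem_union, Set.mem_range, Sum.inl.injEq, reduceCtorEq,
      exists_false, or_false, Sum.inr.injEq, false_or] at hp hl
    obtain ⟨i, rfl⟩ := hp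
    obtain ⟨j, rfl⟩ := hl
    have e4 : i + 3 + 1 = i := by clear * -; revert i; decide
    have e3 : i + 2 + 1 = i + 3 := by clear * -; revert i; decide
    have e2 : i + 1 + 1 = i + 2 := by clear * -; revert i; decide
    have hj : j = i ∨ j = i + 1 ∨ j = i + 2 ∨ j = i + 3 := by clear * -; revert i j; decide
    have a3 := (hinc (i + 3)).2
    rw [e4] at a3
    rcases hj with rfl | rfl | rfl | rfl
    · exact absurd (hinc _).1 hpl
    · exact ⟨P' (i + 1), L' i, (hinc i).1, (hinc i).2, (hinc (i + 1)).1⟩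
    · refine ⟨P' (i + 3), L' (i + 3), a3, (hinc _).1, ?_⟩
      have := (hinc (i + 2)).2
      rwa [e3] at this
    · exact absurd a3 hpl
  exists_point_ne := by
    intro p l
    obtain ⟨A, ⟨P', L', ⟨hP, -, hinc⟩, rfl⟩, hl, -⟩ := h.exists_apartment (Sum.inr l) (Sum.inl p)
    simp only [gonElements, Set.mem_union, Set.mem_range, reduceCtorEq,
      exists_false, Sum.inr.injEq, false_or] at hl
    obtain ⟨i, rfl⟩ := hl
    have hne : P' i ≠ P' (i + 1) := fun e => by simpa using hP e
    by_cases hp : P' i = p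
    · exact ⟨P' (i + 1), hp ▸ hne.symm, (hinc i).2⟩
    · exact ⟨P' i, hp, (hinc i).1⟩
  exists_line_ne := by
    intro l p
    obtain ⟨A, ⟨P', L', ⟨-, hL, hinc⟩, rfl⟩, hp, -⟩ := h.exists_apartment (Sum.inl p) (Sum.inr l)
    simp only [gonElements, Set.mem_union, Set.mem_range, reduceCtorEq,
      exists_false, Sum.inl.injEq, or_false] at hp
    obtain ⟨i, rfl⟩ := hp
    have hne : L' i ≠ L' (i - 1) := fun e => by simpa [eq_sub_iff_add_eq] using hL e
    have h2 := (hinc (i - 1)).2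
    rw [sub_add_cancel] at h2
    by_cases hp : L' i = l
    · exact ⟨L' (i - 1), hp ▸ hne.symm, h2⟩
    · exact ⟨L' i, hp, (hinc i).1⟩

namespace IsQuad
variable {P L : Type*} {Γ : PointLineGeometry P L}

lemma point_unique (h : Γ.IsQuad) {p q : P} {l m : L} (hlm : l ≠ m) (h1 : Γ.Inc p l)
    (h2 : Γ.Inc p m) (h3 : Γ.Inc q l) (h4 : Γ.Inc q m) : p = q :=
  h.dual.line_unique hlm h1 h2 h3 h4

/-- The projection of a point on a line is unique. -/
lemma proj_unique (h : Γ.IsQuad) {p q q' : P} {l m m' : L} (hpl : ¬ Γ.Inc p l)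
    (h1 : Γ.Inc p m) (h2 : Γ.Inc q m) (h3 : Γ.Inc q l)
    (h1' : Γ.Inc p m') (h2' : Γ.Inc q' m') (h3' : Γ.Inc q' l) : q = q' ∧ m = m' := by
  have hpq : p ≠ q := fun e => hpl (e ▸ h3)
  have hpq' : p ≠ q' := fun e => hpl (e ▸ h3')
  have hml : m ≠ l := fun e => hpl (e ▸ h1)
  have hqq : q = q' := by
    by_contra hqq
    exact hml (h.triangle h1 h2 h3 h3' h2' h1' hpq hqq hpq')
  subst hqq
  exact ⟨rfl, h.line_unique hpq h1 h2 h1' h2'⟩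

/-- Non-collinear points are on equally many lines. -/
lemma ncard_linesOn_eq (h : Γ.IsQuad) {p q : P} (hpq : ¬ Γ.Collinear p q) :
    (Γ.linesOn p).ncard = (Γ.linesOn q).ncard := by
  -- Projecting the other point on a line gives inverse bijections between the two pencils. The
  -- incidence is an inner hypothesis so that `choose` yields total functions.
  have key : ∀ {p q : P}, ¬ Γ.Collinear p q → ∀ l, ∃ m, Γ.Inc p l →
      Γ.Inc q m ∧ ∃ z, Γ.Inc z l ∧ Γ.Inc z m := by
    intro p q hpq l
    by_cases hl : Γ.Inc p l
    · obtain ⟨z, m, h1, h2, h3⟩ := h.exists_proj (p := q) (l := l) (fun e => hpq ⟨l, hl, e⟩)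
      exact ⟨m, fun _ => ⟨h1, z, h3, h2⟩⟩
    · exact ⟨l, fun e => absurd e hl⟩
  have hqp : ¬ Γ.Collinear q p := fun ⟨l, a, b⟩ => hpq ⟨l, b, a⟩
  choose f hf using key hpq
  choose g hg using key hqp
  have inv : ∀ {p q : P} (_ : ¬ Γ.Collinear p q) (l m l' : L), Γ.Inc p l → Γ.Inc q m →
      Γ.Inc p l' → (∃ z, Γ.Inc z l ∧ Γ.Inc z m) → (∃ z, Γ.Inc z m ∧ Γ.Inc z l') → l' = l := by
    rintro p q hpq l m l' h1 h2 h3 ⟨z, h4, h5⟩ ⟨w, h6, h7⟩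
    exact (h.proj_unique (fun e => hpq ⟨m, e, h2⟩) h3 h7 h6 h1 h4 h5).2
  refine Set.BijOn.ncard_eq (f := f) (Set.InvOn.bijOn (f' := g) ⟨?_, ?_⟩ ?_ ?_)
  · intro l hl
    exact inv hpq l (f l) _ hl (hf l hl).1 (hg _ (hf l hl).1).1 (hf l hl).2 (hg _ (hf l hl).1).2
  · intro m hm
    exact inv hqp m (g m) _ hm (hg m hm).1 (hf _ (hg m hm).1).1 (hg m hm).2 (hf _ (hg m hm).1).2
  · exact fun l hl => (hf l hl).1
  · exact fun l hl => (hg l hl).1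

/-- The points of an ordinary pentagon are on at least three lines. -/
lemma two_lt_ncard_of_five_gon [Finite L] (h : Γ.IsQuad) {p : Fin 5 → P} {l : Fin 5 → L}
    (hg : Γ.IsOrdinaryGon 5 p l) (i : Fin 5) : 2 < (Γ.linesOn (p i)).ncard := by
  obtain ⟨hp, hl, hinc⟩ := hg
  have e1 : i + 1 + 1 = i + 2 := by clear * -; revert i; decide
  have e2 : i + 2 + 1 = i + 3 := by clear * -; revert i; decide
  have e3 : i + 3 + 1 = i + 4 := by clear * -; revert i; decide
  have e4 : i + 4 + 1 = i := by clear * -; revert i; decide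
  have i0 := hinc i
  have i1 := hinc (i + 1)
  have i2 := hinc (i + 2)
  have i3 := hinc (i + 3)
  have i4 := hinc (i + 4)
  rw [e1] at i1; rw [e2] at i2; rw [e3] at i3; rw [e4] at i4
  have ne : ∀ j k : Fin 5, j ≠ k → l (i + j) ≠ l (i + k) := fun j k hjk e =>
    hjk (add_left_cancel (hl e))
  have pe : ∀ j k : Fin 5, j ≠ k → p (i + j) ≠ p (i + k) := fun j k hjk e =>
    hjk (add_left_cancel (hp e))
  have l01 := ne 0 1 (by decide)
  have l12 := ne 1 2 (by decide)
  have l02 := ne 0 2 (by decide)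
  have l24 := ne 2 4 (by decide)
  have l34 := ne 3 4 (by decide)
  have l04 := ne 0 4 (by decide)
  have l23 := ne 2 3 (by decide)
  have p01 := pe 0 1 (by decide)
  have p02 := pe 0 2 (by decide)
  have p12 := pe 1 2 (by decide)
  have p34 := pe 3 4 (by decide)
  have p03 := pe 0 3 (by decide)
  have p04 := pe 0 4 (by decide)
  simp only [add_zero] at l01 l02 l04 p01 p02 p03 p04
  have h0 : ¬ Γ.Inc (p i) (l (i + 2)) := fun e =>
    l01 (h.triangle i0.1 i0.2 i1.1 i1.2 i2.1 e p01 p12 p02)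
  -- The third line on a vertex joins it to the opposite side of the pentagon.
  obtain ⟨u, m, h1, h2, h3⟩ := h.exists_proj h0
  have hm0 : m ≠ l i := by
    rintro rfl
    exact p12 (h.dual.triangle i0.2 i1.1 i1.2 i2.1 h3 h2 l01 l12 l02)
  have hm4 : m ≠ l (i + 4) := by
    rintro rfl
    exact p34 (h.dual.triangle i2.2 i3.1 i3.2 i4.1 h2 h3 l23 l34 l24)
  rw [Set.two_lt_ncard_iff]
  exact ⟨l i, l (i + 4), m, i0.1, i4.2, h1, l04, hm0.symm, hm4.symm⟩

/-- No point is collinear with all points of an ordinary pentagon. -/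
lemma exists_not_collinear_of_five_gon (h : Γ.IsQuad) {p : Fin 5 → P} {l : Fin 5 → L}
    (hg : Γ.IsOrdinaryGon 5 p l) (x : P) : ∃ i, ¬ Γ.Collinear x (p i) := by
  obtain ⟨hp, hl, hinc⟩ := hg
  by_contra! hx
  have key : ∀ i, Γ.Inc x (l i) := by
    intro i
    obtain ⟨n, h1, h2⟩ := hx i
    obtain ⟨m, h3, h4⟩ := hx (i + 1)
    by_cases e1 : p i = x
    · exact e1 ▸ (hinc i).1
    by_cases e2 : p (i + 1) = x
    · exact e2 ▸ (hinc i).2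
    have := h.triangle (hinc i).1 (hinc i).2 h4 h3 h1 h2 (fun e => by simpa using hp e) e2 e1
    exact this ▸ h3
  have h1 : x = p 1 := h.point_unique (hl.ne (by decide : (0 : Fin 5) ≠ 1)) (key 0) (key 1)
    (hinc 0).2 (hinc 1).1
  have h2 : x = p 2 := h.point_unique (hl.ne (by decide : (1 : Fin 5) ≠ 2)) (key 1) (key 2)
    (hinc 1).2 (hinc 2).1
  exact absurd (hp (h1.symm.trans h2)) (by decide)

lemma two_lt_ncard_linesOn [Finite L] (h : Γ.IsQuad) {p : Fin 5 → P} {l : Fin 5 → L}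
    (hg : Γ.IsOrdinaryGon 5 p l) (x : P) : 2 < (Γ.linesOn x).ncard := by
  obtain ⟨i, hi⟩ := h.exists_not_collinear_of_five_gon hg x
  exact h.ncard_linesOn_eq hi ▸ h.two_lt_ncard_of_five_gon hg i

/-- Any two points of a thick quadrangle are on equally many lines. -/
lemma ncard_linesOn_eq_of_thick [Finite P] (h : Γ.IsQuad)
    (hthick : ∀ l, 2 < (Γ.pointsOn l).ncard) (p q : P) :
    (Γ.linesOn p).ncard = (Γ.linesOn q).ncard := by
  by_cases hpq : Γ.Collinear p q
  swap
  · exact h.ncard_linesOn_eq hpq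
  obtain rfl | hne := eq_or_ne p q
  · rfl
  obtain ⟨n, hpn, hqn⟩ := hpq
  -- Collinear points are compared through a point `v` collinear with neither, taken on a second
  -- line through a third point of their joining line.
  obtain ⟨w, hwn, hw⟩ := Set.exists_mem_notMem_of_ncard_lt_ncard
    (s := {p, q}) (t := Γ.pointsOn n) ((Set.ncard_pair hne).trans_lt (hthick n))
  obtain ⟨k, hk, hwk⟩ := h.exists_line_ne n w
  obtain ⟨v, hv, hvk⟩ := h.exists_point_ne w k
  simp only [Set.mem_insert_iff, Set.mem_singleton_iff, not_or] at hw
  have key : ∀ r, Γ.Inc r n → w ≠ r → ¬ Γ.Collinear r v := by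
    rintro r hr hrw ⟨m, hm, hm'⟩
    by_cases hrv : r = v
    · subst hrv
      exact hk (h.line_unique hrw hwk hvk hwn hr)
    · exact hk (h.triangle hvk hwk hwn hr hm hm' hv hrw (Ne.symm hrv))
  rw [h.ncard_linesOn_eq (key p hpn hw.1), h.ncard_linesOn_eq (key q hqn hw.2)]

end IsQuad

/-- A finite generalized quadrangle has an order. -/
lemma IsGeneralizedQuadrangle.exists_hasOrder {P L : Type*} [Finite P] [Finite L]
    {Γ : PointLineGeometry P L} (hΓ : Γ.IsGeneralizedQuadrangle) :
    ∃ s t, 2 ≤ s ∧ 2 ≤ t ∧ Γ.HasOrder s t := by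
  have h := hΓ.isQuad
  obtain ⟨p, l, hg⟩ := hΓ.exists_five_gon
  have h1 : ∀ q, 2 < (Γ.linesOn q).ncard := h.two_lt_ncard_linesOn hg
  have h2 : ∀ m, 2 < (Γ.pointsOn m).ncard := h.dual.two_lt_ncard_linesOn hg.dual
  refine ⟨(Γ.pointsOn (l 0)).ncard - 1, (Γ.linesOn (p 0)).ncard - 1, ?_, ?_, ?_, ?_⟩
  · have := h2 (l 0); omega
  · have := h1 (p 0); omega
  · intro m
    have e : (Γ.pointsOn m).ncard = (Γ.pointsOn (l 0)).ncard :=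
      h.dual.ncard_linesOn_eq_of_thick h1 m (l 0)
    have := h2 (l 0); omega
  · intro q
    have e := h.ncard_linesOn_eq_of_thick h2 q (p 0)
    have := h1 (p 0); omega

end PointLineGeometry

/-! ### Benson's congruence -/

/-- The trace of a complex matrix with `M ^ (k + 1) = M` is an algebraic integer. -/
lemma Matrix.isIntegral_trace_of_pow_succ_eq {n : Type*} [Fintype n] [DecidableEq n]
    {M : Matrix n n ℂ} {k : ℕ} (hk : k ≠ 0) (hM : M ^ (k + 1) = M) : IsIntegral ℤ M.trace := by
  rw [Matrix.trace_eq_sum_roots_charpoly]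
  refine IsIntegral.multiset_sum fun μ hμ => ?_
  have hμ' : μ ∈ spectrum ℂ M :=
    Matrix.mem_spectrum_iff_isRoot_charpoly.2 (Polynomial.isRoot_of_mem_roots hμ)
  have hnt : Nontrivial (Matrix n n ℂ) := by
    by_contra h
    rw [not_nontrivial_iff_subsingleton] at h
    exact hμ' (isUnit_of_subsingleton _)
  have h1 := spectrum.subset_polynomial_aeval M (Polynomial.X ^ (k + 1) - Polynomial.X : Polynomial ℂ)
    ⟨μ, hμ', rfl⟩
  simp only [map_sub, map_pow, Polynomial.aeval_X, hM, sub_self, spectrum.zero_eq,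
    Set.mem_singleton_iff, Polynomial.eval_sub, Polynomial.eval_pow, Polynomial.eval_X] at h1
  refine ⟨Polynomial.X ^ (k + 1) - Polynomial.X, ?_, by simpa using h1⟩
  refine Polynomial.monic_X_pow_sub ?_
  rw [Polynomial.degree_X]
  norm_cast
  omega

namespace PointLineGeometry
variable {P L : Type*} {Γ : PointLineGeometry P L}

open Classical in
/-- The incidence matrix. -/
noncomputable def incMatrix (Γ : PointLineGeometry P L) : Matrix P L ℂ :=
  Matrix.of fun p l => if Γ.Inc p l then 1 else 0

open Classical in
lemma incMatrix_apply (p : P) (l : L) : Γ.incMatrix p l = if Γ.Inc p l then 1 else 0 := rfl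

lemma sum_incMatrix_row [Fintype L] {s t : ℕ} (ho : Γ.HasOrder s t) (p : P) :
    ∑ l, Γ.incMatrix p l = t + 1 := by
  classical
  simp only [incMatrix_apply, Finset.sum_boole]
  have := ho.2 p
  rw [Set.ncard_eq_toFinset_card'] at this
  rw [← Nat.cast_succ, Nat.succ_eq_add_one, ← this]
  congr 2
  ext l
  rw [Finset.mem_filter_univ, Set.mem_toFinset]
  rfl

lemma sum_incMatrix_col [Fintype P] {s t : ℕ} (ho : Γ.HasOrder s t) (l : L) :
    ∑ p, Γ.incMatrix p l = s + 1 := by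
  classical
  simp only [incMatrix_apply, Finset.sum_boole]
  have := ho.1 l
  rw [Set.ncard_eq_toFinset_card'] at this
  rw [← Nat.cast_succ, Nat.succ_eq_add_one, ← this]
  congr 2
  ext l
  rw [Finset.mem_filter_univ, Set.mem_toFinset]
  rfl

open Matrix in
lemma incMatrix_mul_transpose_mul [Fintype P] [Fintype L] (h : Γ.IsQuad) {s t : ℕ}
    (ho : Γ.HasOrder s t) :
    Γ.incMatrix * (Γ.incMatrixᵀ * Γ.incMatrix) =
      ((s : ℂ) + t) • Γ.incMatrix + Matrix.of fun _ _ => 1 := by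
  classical
  have hself : ∀ l, (Γ.incMatrixᵀ * Γ.incMatrix) l l = s + 1 := by
    intro l
    rw [Matrix.mul_apply, ← sum_incMatrix_col ho l]
    refine Finset.sum_congr rfl fun p _ => ?_
    simp [incMatrix_apply]
  have hone : ∀ {l m p}, l ≠ m → Γ.Inc p l → Γ.Inc p m →
      (Γ.incMatrixᵀ * Γ.incMatrix) l m = 1 := by
    intro l m p hlm hl hm
    rw [Matrix.mul_apply, Finset.sum_eq_single p]
    · simp [incMatrix_apply, hl, hm]
    · intro q _ hq
      by_cases h1 : Γ.Inc q l
      · have : ¬ Γ.Inc q m := fun h2 => hq (h.point_unique hlm h1 h2 hl hm)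
        simp [incMatrix_apply, this]
      · simp [incMatrix_apply, h1]
    · simp
  have hzero : ∀ {l m}, (∀ p, Γ.Inc p l → ¬ Γ.Inc p m) →
      (Γ.incMatrixᵀ * Γ.incMatrix) l m = 0 := by
    intro l m hlm
    rw [Matrix.mul_apply]
    refine Finset.sum_eq_zero fun p _ => ?_
    by_cases h1 : Γ.Inc p l
    · simp [incMatrix_apply, hlm p h1]
    · simp [incMatrix_apply, h1]
  ext z l
  rw [Matrix.mul_apply, Matrix.add_apply, Matrix.smul_apply, Matrix.of_apply, smul_eq_mul]
  by_cases hz : Γ.Inc z l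
  · have : ∀ m, Γ.incMatrix z m * (Γ.incMatrixᵀ * Γ.incMatrix) m l =
        Γ.incMatrix z m + if m = l then (s : ℂ) else 0 := by
      intro m
      by_cases hml : m = l
      · subst hml
        simp [hself, incMatrix_apply, hz, add_comm]
      · by_cases hm : Γ.Inc z m
        · simp [hone hml hm hz, hml]
        · simp [incMatrix_apply, hm, hml]
    rw [Finset.sum_congr rfl fun m _ => this m, Finset.sum_add_distrib, sum_incMatrix_row ho]
    simp only [Finset.sum_ite_eq', Finset.mem_univ, if_true, incMatrix_apply, hz]
    ring
  · obtain ⟨q, m, h1, h2, h3⟩ := h.exists_proj hz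
    have hml : m ≠ l := by
      rintro rfl
      exact hz h1
    rw [Finset.sum_eq_single m]
    · rw [hone hml h2 h3]
      simp [incMatrix_apply, h1, hz]
    · intro m' _ hm'
      by_cases h4 : Γ.Inc z m'
      · rw [hzero, mul_zero]
        exact fun q' h5 h6 => hm' (h.proj_unique hz h4 h5 h6 h1 h2 h3).2
      · simp [incMatrix_apply, h4]
    · simp

open Matrix in
/-- **Benson's congruence**. -/
theorem benson [Finite P] [Finite L] (h : Γ.IsQuad) {s t : ℕ} (ho : Γ.HasOrder s t)
    (hs : s ≠ 0) [Nonempty P] (σ : Equiv.Perm P) (τ : Equiv.Perm L)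
    (hστ : ∀ p l, Γ.Inc (σ p) (τ l) ↔ Γ.Inc p l) :
    ((s : ℤ) + t) ∣ (Nat.card {zl : P × L // Γ.Inc zl.1 zl.2 ∧ Γ.Inc (σ zl.1) zl.2} : ℤ) -
      (s + 1) * (t + 1) := by
  classical
  have := Fintype.ofFinite P
  have := Fintype.ofFinite L
  set D : Matrix P P ℂ := Γ.incMatrix * Γ.incMatrixᵀ with hD
  set J : Matrix P P ℂ := Matrix.of fun _ _ => 1 with hJ
  have hJL : (Matrix.of fun _ _ => 1 : Matrix P L ℂ) * Γ.incMatrixᵀ = ((t : ℂ) + 1) • J := by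
    ext z w
    simp [Matrix.mul_apply, J, sum_incMatrix_row ho]
  have hDD : D * D = ((s : ℂ) + t) • D + ((t : ℂ) + 1) • J := by
    rw [← hJL, hD, ← Matrix.smul_mul, ← Matrix.add_mul, ← incMatrix_mul_transpose_mul h ho]
    simp only [Matrix.mul_assoc]
  have hDJ : D * J = (((s : ℂ) + 1) * (t + 1)) • J := by
    ext z w
    have : ∀ u, D z u = ∑ l, Γ.incMatrix z l * Γ.incMatrix u l := fun u => by
      simp [hD, Matrix.mul_apply]
    simp only [Matrix.mul_apply, J, Matrix.of_apply, mul_one, Matrix.smul_apply, smul_eq_mul]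
    simp only [this]
    rw [Finset.sum_comm]
    simp only [← Finset.mul_sum, sum_incMatrix_col ho, ← Finset.sum_mul, sum_incMatrix_row ho]
    ring
  have hDs : ∀ z w, D z w = D w z := fun z w => by
    simp [hD, Matrix.mul_apply, mul_comm]
  have hJD : J * D = (((s : ℂ) + 1) * (t + 1)) • J := by
    have := congrArg Matrix.transpose hDJ
    rw [Matrix.transpose_mul, Matrix.transpose_smul] at this
    have e1 : Dᵀ = D := by ext z w; exact hDs w z
    have e2 : Jᵀ = J := rfl
    rwa [e1, e2] at this
  have hJJ : J * J = (Fintype.card P : ℂ) • J := by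
    ext z w; simp [J, Matrix.mul_apply]
  have hst0 : (s : ℂ) + t ≠ 0 := by norm_cast; omega
  have hst1 : (s : ℂ) * t + 1 ≠ 0 := by norm_cast
  have hs1 : (s : ℂ) + 1 ≠ 0 := by norm_cast
  have ht1 : (t : ℂ) + 1 ≠ 0 := by norm_cast
  obtain ⟨z₀⟩ := ‹Nonempty P›
  -- The number of points results from evaluating `D * D * J` in two ways.
  have hv : (Fintype.card P : ℂ) = (s + 1) * (s * t + 1) := by
    have e : (D * D * J) z₀ z₀ = (D * (D * J)) z₀ z₀ := by rw [Matrix.mul_assoc]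
    rw [hDD, hDJ, Matrix.add_mul, Matrix.smul_mul, Matrix.smul_mul, Matrix.mul_smul, hDJ, hJJ] at e
    simp only [Matrix.add_apply, Matrix.smul_apply, smul_eq_mul, J, Matrix.of_apply, mul_one] at e
    apply mul_left_cancel₀ ht1
    linear_combination e
  -- This constant makes `D - c • J` annihilate the all-one vector. What is left of `D` satisfies `R
  -- * R = (s + t) • R`, so dividing by `s + t` gives an idempotent.
  set c : ℂ := (t + 1) / (s * t + 1) with hc
  have hc' : c * (s * t + 1) = t + 1 := by rw [hc, div_mul_cancel₀ _ hst1]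
  set R : Matrix P P ℂ := D - c • J with hR
  have hRR : R * R = ((s : ℂ) + t) • R := by
    rw [hR, Matrix.sub_mul, Matrix.mul_sub, Matrix.mul_sub, Matrix.smul_mul, Matrix.mul_smul,
      Matrix.mul_smul, Matrix.smul_mul, hDD, hDJ, hJD, hJJ, hv]
    ext z w
    simp only [Matrix.add_apply, Matrix.sub_apply, Matrix.smul_apply, smul_eq_mul, J,
      Matrix.of_apply]
    linear_combination (c * (s + 1) - 1) * hc'
  set E : Matrix P P ℂ := ((s : ℂ) + t)⁻¹ • R with hE
  have hEE : E * E = E := by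
    rw [hE, Matrix.smul_mul, Matrix.mul_smul, hRR, inv_smul_smul₀ hst0]
  set Q : Matrix P P ℂ := σ.permMatrix ℂ with hQ
  have hQM : ∀ M : Matrix P P ℂ, Q * M = M.submatrix σ id := fun M =>
    PEquiv.toMatrix_toPEquiv_mul _ _
  have hMQ : ∀ M : Matrix P P ℂ, M * Q = M.submatrix id σ.symm := fun M =>
    PEquiv.mul_toMatrix_toPEquiv _ _
  have hDσ : ∀ z w, D (σ z) (σ w) = D z w := by
    intro z w
    simp only [hD, Matrix.mul_apply, Matrix.transpose_apply]
    rw [← Equiv.sum_comp τ]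
    refine Finset.sum_congr rfl fun l _ => ?_
    simp [incMatrix_apply, hστ]
  have hcomm : Commute Q E := by
    rw [Commute, SemiconjBy, hQM, hMQ]
    ext z w
    have := hDσ z (σ.symm w)
    rw [Equiv.apply_symm_apply] at this
    simp [hE, hR, J, this]
  obtain ⟨n, hn, hσn⟩ : ∃ n, n ≠ 0 ∧ σ ^ n = 1 :=
    ⟨orderOf σ, (orderOf_pos σ).ne', pow_orderOf_eq_one σ⟩
  have hQpow : ∀ k : ℕ, Q ^ k = (σ ^ k).permMatrix ℂ := by
    intro k
    induction k with
    | zero => simp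
    | succ k ih => rw [pow_succ, ih, pow_succ', Matrix.permMatrix_mul]
  have hEpow : ∀ k : ℕ, E ^ (k + 1) = E := by
    intro k
    induction k with
    | zero => simp
    | succ k ih => rw [pow_succ, ih, hEE]
  -- The permutation matrix has finite order and commutes with the idempotent, so the eigenvalues of
  -- the product are zero or roots of unity and its trace is an algebraic integer.
  have hQE : (Q * E) ^ (n + 1) = Q * E := by
    rw [hcomm.mul_pow, hEpow, hQpow, pow_succ, hσn, one_mul]
  have hint := Matrix.isIntegral_trace_of_pow_succ_eq hn hQE
  have htr : ((s : ℂ) + t) * (Q * E).trace =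
      (Nat.card {zl : P × L // Γ.Inc zl.1 zl.2 ∧ Γ.Inc (σ zl.1) zl.2} : ℂ) -
        (s + 1) * (t + 1) := by
    rw [hE, Matrix.mul_smul, Matrix.trace_smul, smul_eq_mul, mul_inv_cancel_left₀ hst0, hQM]
    simp only [Matrix.trace, Matrix.diag, Matrix.submatrix_apply, id, hR, Matrix.sub_apply,
      Matrix.smul_apply, J, Matrix.of_apply, smul_eq_mul, mul_one, Finset.sum_sub_distrib,
      Finset.sum_const, Finset.card_univ, nsmul_eq_mul, hv]
    congr 1
    · rw [Nat.card_eq_fintype_card, Fintype.card_subtype, ← Finset.sum_boole,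
        Fintype.sum_prod_type]
      refine Finset.sum_congr rfl fun z _ => ?_
      simp only [hD, Matrix.mul_apply, Matrix.transpose_apply, incMatrix_apply]
      refine Finset.sum_congr rfl fun l _ => ?_
      by_cases h1 : Γ.Inc z l <;> by_cases h2 : Γ.Inc (σ z) l <;> simp [h1, h2]
    · linear_combination (s + 1) * hc'
  set X : ℤ := (Nat.card {zl : P × L // Γ.Inc zl.1 zl.2 ∧ Γ.Inc (σ zl.1) zl.2} : ℤ) -
      (s + 1) * (t + 1) with hX
  have hq : (Q * E).trace = algebraMap ℚ ℂ ((X : ℚ) / (s + t)) := by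
    rw [eq_comm, map_div₀]
    have : ((s : ℂ) + t) * (Q * E).trace = X := by rw [htr, hX]; push_cast; rfl
    rw [div_eq_iff (by simpa using hst0), mul_comm]
    simpa using this.symm
  -- The trace is the rational number `X / (s + t)` and an algebraic integer, hence an integer.
  rw [hq, isIntegral_algebraMap_iff (algebraMap ℚ ℂ).injective,
    IsIntegrallyClosed.isIntegral_iff] at hint
  obtain ⟨y, hy⟩ := hint
  have hst0' : (s : ℚ) + t ≠ 0 := by norm_cast; omega
  refine ⟨y, ?_⟩
  rw [eq_div_iff hst0'] at hy
  have : ((y * (s + t) : ℤ) : ℚ) = X := by push_cast; simpa using hy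
  rw [mul_comm]
  exact_mod_cast this.symm

end PointLineGeometry

/-! ### A centrality criterion for normal subgroups of nilpotent groups -/

open Subgroup in
/-- A multiplicative character of a nontrivial central subgroup, extended by one. -/
lemma exists_character_ne_one_of_le_center {G : Type*} [Group G] [Finite G] {M : Subgroup G}
    (hM : M ≤ center G) (hne : M ≠ ⊥) :
    ∃ c : G → ℂˣ, (∀ g ∈ M, ∀ h ∈ M, c (g * h) = c g * c h) ∧ ∃ m ∈ M, c m ≠ 1 := by
  classical
  let _ : CommGroup M :=
    { (inferInstance : Group M) with
      mul_comm := fun a b => Subtype.ext (mem_center_iff.1 (hM b.2) a) }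
  obtain ⟨m, hm, hm1⟩ := M.ne_bot_iff_exists_ne_one.1 hne |> fun ⟨a, ha⟩ =>
    (⟨a, a.2, fun e => ha (Subtype.ext e)⟩ : ∃ m, m ∈ M ∧ m ≠ 1)
  obtain ⟨φ, hφ⟩ := CommGroup.exists_apply_ne_one_of_hasEnoughRootsOfUnity M ℂ
    (a := ⟨m, hm⟩) (fun e => hm1 (congrArg Subtype.val e))
  refine ⟨fun g => if h : g ∈ M then φ ⟨g, h⟩ else 1, fun g hg h hh => ?_, m, hm, ?_⟩
  · simp only [hg, hh, mul_mem hg hh, dif_pos, ← map_mul]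
    rfl
  · simpa only [hm, dif_pos] using hφ

/-- A finite set of linear characters of a finite group which are trivial on a nontrivial normal
subgroup is smaller than the group. -/
lemma card_lt_of_injective_monoidHom {S T : Type*} [Group S] [Finite S] [Finite T]
    (N : Subgroup S) [N.Normal] (hN : N ≠ ⊥) (ψ : T → S →* ℂˣ) (hψ : Function.Injective ψ)
    (htriv : ∀ a, ∀ m ∈ N, ψ a m = 1) : Nat.card T < Nat.card S := by
  classical
  have := Fintype.ofFinite T
  have := Fintype.ofFinite (S ⧸ N)
  let f : T → (S ⧸ N) →* ℂ := fun a =>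
    (Units.coeHom ℂ).comp (QuotientGroup.lift N (ψ a) (htriv a))
  have hf : Function.Injective f := by
    intro a b hab
    refine hψ (MonoidHom.ext fun σ => Units.ext ?_)
    exact DFunLike.congr_fun hab (QuotientGroup.mk σ)
  have hli := (linearIndependent_monoidHom (S ⧸ N) ℂ).comp f hf
  have h1 := hli.fintype_card_le_finrank
  rw [Module.finrank_fintype_fun_eq_card, ← Nat.card_eq_fintype_card,
    ← Nat.card_eq_fintype_card] at h1
  have h2 := Subgroup.card_eq_card_quotient_mul_card_subgroup N
  have h3 : 1 < Nat.card N := (Subgroup.one_lt_card_iff_ne_bot N).2 hN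
  have h4 : 0 < Nat.card (S ⧸ N) := Nat.card_pos
  rw [h2]
  nlinarith

namespace Subgroup

open scoped commutatorElement

/-- A version of `le_center_of_forall_exists_commutator` for class three. -/
lemma le_center_of_commutator_le_center {G ι : Type*} [Group G] [Finite G] [Nonempty ι]
    (A : ι → Subgroup G) (S : Subgroup G) [S.Normal] (hGS : _root_.commutator G ≤ S)
    (hcomm : ∀ i, ∀ a ∈ A i, ∀ b ∈ A i, a * b = b * a)
    (hcard : ∀ i, Nat.card S ≤ Nat.card (A i))
    (hgen : ∀ H : Subgroup G, S ≤ H → (∀ i, A i ≤ H) → H = ⊤)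
    (hcam : ∀ i, ∀ a ∈ A i, a ≠ 1 → ∀ τ ∈ S, ∃ h, ⁅a, h⁆ = τ)
    (hM : ⁅(⊤ : Subgroup G), S⁆ ≤ center G) : S ≤ center G := by
  rw [← commutator_top_left_eq_bot_iff_le_center]
  by_contra hne
  set M := ⁅(⊤ : Subgroup G), S⁆ with hMdef
  have hMS : M ≤ S := commutator_le_right _ _
  have hmem : ∀ x, ∀ σ ∈ S, ⁅x, σ⁆ ∈ M := fun x σ hσ => commutator_mem_commutator (mem_top x) hσ
  have hcen : ∀ m ∈ M, ∀ x, x * m * x⁻¹ = m := fun m hm x => by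
    rw [mem_center_iff.1 (hM hm) x, mul_inv_cancel_right]
  obtain ⟨c, hc, m, hm, hcm⟩ := exists_character_ne_one_of_le_center hM hne
  have hc1 : c 1 = 1 := by simpa using hc 1 M.one_mem 1 M.one_mem
  have hl : ∀ x y : G, ∀ σ ∈ S, c ⁅x * y, σ⁆ = c ⁅x, σ⁆ * c ⁅y, σ⁆ := by
    intro x y σ hσ
    rw [commutatorElement_mul_left_eq_conj_mul, hcen _ (hmem y σ hσ),
      hc _ (hmem y σ hσ) _ (hmem x σ hσ), mul_comm]
  have hr : ∀ x : G, ∀ σ ∈ S, ∀ τ ∈ S, c ⁅x, σ * τ⁆ = c ⁅x, σ⁆ * c ⁅x, τ⁆ := by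
    intro x σ hσ τ hτ
    rw [commutatorElement_mul_right_eq_mul_conj, mul_assoc, mul_assoc, ← mul_assoc σ,
      hcen _ (hmem x τ hτ), hc _ (hmem x σ hσ) _ (hmem x τ hτ)]
  -- Because `M = [G, S]` is central, `(x, σ) ↦ c ⁅x, σ⁆` is multiplicative in both variables. The
  -- goal is that its left kernel is all of `G`, which contradicts `c ≠ 1` on `M`.
  let ψ : G →* (S →* ℂˣ) := MonoidHom.mk' (fun x => MonoidHom.mk' (fun σ => c ⁅x, (σ : G)⁆)
    fun σ τ => hr x σ σ.2 τ τ.2) fun x y => MonoidHom.ext fun σ => hl x y σ σ.2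
  have hker : ∀ {x}, x ∈ ψ.ker ↔ ∀ σ ∈ S, c ⁅x, σ⁆ = 1 := by
    intro x
    rw [MonoidHom.mem_ker]
    exact ⟨fun h σ hσ => DFunLike.congr_fun h ⟨σ, hσ⟩, fun h => MonoidHom.ext fun σ => h σ σ.2⟩
  have hGker : _root_.commutator G ≤ ψ.ker := Abelianization.commutator_subset_ker ψ
  have hcomG : ∀ x y : G, ⁅x, y⁆ ∈ _root_.commutator G := fun x y =>
    commutator_mem_commutator (mem_top x) (mem_top y)
  -- Otherwise `A i` would embed into the characters of `S` that are trivial on `M ≠ 1`, and there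
  -- are fewer of these than `|S| ≤ |A i|`.
  have hexists : ∀ i, ∃ a ∈ A i, a ≠ 1 ∧ a ∈ ψ.ker := by
    intro i
    by_contra! hi
    refine absurd (hcard i) (not_le.2 ?_)
    have hN : M.subgroupOf S ≠ ⊥ := by
      rw [Ne, subgroupOf_eq_bot, disjoint_iff, inf_eq_left.2 hMS]
      exact hne
    refine card_lt_of_injective_monoidHom (M.subgroupOf S) hN (fun a : A i => ψ a) ?_ ?_
    · intro a b hab
      have : ((a * b⁻¹ : A i) : G) ∈ ψ.ker := by
        rw [MonoidHom.mem_ker]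
        push_cast
        rw [map_mul, map_inv]
        exact mul_inv_eq_one.2 hab
      by_contra hne'
      exact hi _ (a * b⁻¹).2 (fun e => hne' (mul_inv_eq_one.1 (Subtype.ext e))) this
    · intro a σ hσ
      change c ⁅(a : G), (σ : G)⁆ = 1
      rw [commutatorElement_eq_one_iff_mul_comm.2, hc1]
      exact mem_center_iff.1 (hM (mem_subgroupOf.1 hσ)) a
  have hA : ∀ i, A i ≤ ψ.ker := by
    intro i b hb
    obtain ⟨a, ha, ha1, hak⟩ := hexists i
    rw [hker] at hak ⊢
    intro u hu
    obtain ⟨h, rfl⟩ := hcam i a ha ha1 u hu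
    have hv : ⁅b, h⁆ ∈ S := hGS (hcomG b h)
    have hab := hcomm i a ha b hb
    -- This identity, valid since `a` and `b` commute, spreads the kernel from the one element `a`
    -- to all of `A i`: the first factor is killed because `a` is in the kernel, the second because
    -- `⁅b, h⁆` is a commutator.
    have e : ⁅b, ⁅a, h⁆⁆ = ⁅a, ⁅b, h⁆⁆ * ⁅⁅b, h⁆, ⁅a, h⁆⁆ := by
      have h1 : b * ⁅a, h⁆ * b⁻¹ = a * (⁅b, h⁆ * (h * a⁻¹ * h⁻¹) * ⁅b, h⁆⁻¹) := by
        have h2 : b * a * h * a⁻¹ * h⁻¹ * b⁻¹ = a * b * h * a⁻¹ * h⁻¹ * b⁻¹ := by rw [hab]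
        have h3 : b⁻¹ * a⁻¹ = a⁻¹ * b⁻¹ := by rw [← mul_inv_rev, ← mul_inv_rev, hab]
        calc b * ⁅a, h⁆ * b⁻¹ = b * a * h * a⁻¹ * h⁻¹ * b⁻¹ := by
              rw [commutatorElement_def]; group
          _ = a * b * h * a⁻¹ * h⁻¹ * b⁻¹ := h2
          _ = a * b * h * (a⁻¹ * b⁻¹) * b * h⁻¹ * b⁻¹ := by group
          _ = a * b * h * (b⁻¹ * a⁻¹) * b * h⁻¹ * b⁻¹ := by rw [h3]
          _ = _ := by rw [commutatorElement_def]; group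
      rw [commutatorElement_def b, h1]
      simp only [commutatorElement_def]
      group
    rw [e, hc _ (hmem a _ hv) _ (hmem _ _ hu), hak _ hv, hker.1 (hGker (hcomG b h)) _ hu, one_mul]
  have hS : S ≤ ψ.ker := by
    intro τ hτ
    obtain ⟨i⟩ := ‹Nonempty ι›
    obtain ⟨a, ha, ha1, -⟩ := hexists i
    obtain ⟨h, rfl⟩ := hcam i a ha ha1 τ hτ
    exact hGker (hcomG a h)
  have htop := hgen _ hS hA
  have : ∀ g ∈ M, g ∈ M ∧ c g = 1 := by
    intro g hg
    rw [hMdef, commutator_def] at hg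
    induction hg using closure_induction with
    | mem x hx =>
      obtain ⟨x, -, σ, hσ, rfl⟩ := hx
      exact ⟨hmem x σ hσ, hker.1 (htop ▸ mem_top x) σ hσ⟩
    | one => exact ⟨M.one_mem, hc1⟩
    | mul x y _ _ h1 h2 =>
      exact ⟨mul_mem h1.1 h2.1, by rw [hc _ h1.1 _ h2.1, h1.2, h2.2, one_mul]⟩
    | inv x _ h1 =>
      refine ⟨inv_mem h1.1, ?_⟩
      have := hc x h1.1 x⁻¹ (inv_mem h1.1)
      rwa [mul_inv_cancel, hc1, h1.2, one_mul, eq_comm] at this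
  exact hcm (this m hm).2

/-- In a finite nilpotent group, a normal subgroup `S` which contains the commutator subgroup is
central if the group is generated by `S` and abelian subgroups `A i` of order at least that
of `S`, meeting `S` trivially, such that every element of `S` is a commutator with each
nontrivial element of each `A i`. -/
theorem le_center_of_forall_exists_commutator {G ι : Type*} [Group G] [Finite G] [Nonempty ι]
    [Group.IsNilpotent G]
    (A : ι → Subgroup G) (S : Subgroup G) [S.Normal] (hGS : _root_.commutator G ≤ S)
    (hcomm : ∀ i, ∀ a ∈ A i, ∀ b ∈ A i, a * b = b * a)
    (hcard : ∀ i, Nat.card S ≤ Nat.card (A i)) (hAS : ∀ i, ∀ a ∈ A i, a ∈ S → a = 1)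
    (hgen : ∀ H : Subgroup G, S ≤ H → (∀ i, A i ≤ H) → H = ⊤)
    (hcam : ∀ i, ∀ a ∈ A i, a ≠ 1 → ∀ τ ∈ S, ∃ h, ⁅a, h⁆ = τ) : S ≤ center G := by
  set M := ⁅(⊤ : Subgroup G), S⁆ with hM
  set N := ⁅(⊤ : Subgroup G), M⁆ with hN
  have hMS : M ≤ S := commutator_le_right _ _
  have hNS : N ≤ S := (commutator_le_right _ _).trans hMS
  let π := QuotientGroup.mk' N
  have hπ : Function.Surjective π := QuotientGroup.mk'_surjective N
  have hπ1 : ∀ {x}, π x = 1 ↔ x ∈ N := fun {x} => QuotientGroup.eq_one_iff x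
  have hSn : (S.map π).Normal := Normal.map inferInstance π hπ
  -- Modulo `N = [G, [G, S]]` the subgroup `[G, S]` is central, so the class three case applies. The
  -- `A i` keep their orders in the quotient because they meet `S` trivially.
  have key : S.map π ≤ center (G ⧸ N) := by
    refine le_center_of_commutator_le_center (fun i => (A i).map π) (S.map π) ?_ ?_ ?_ ?_ ?_ ?_
    · rw [_root_.commutator_def, ← map_top_of_surjective π hπ, ← map_commutator]
      exact map_mono hGS
    · rintro i _ ⟨a, ha, rfl⟩ _ ⟨b, hb, rfl⟩
      rw [← map_mul, hcomm i a ha b hb, map_mul]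
    · intro i
      have h1 : Nat.card ((A i).map π) = Nat.card (A i) := by
        refine Nat.card_image_of_injOn (s := (A i : Set G)) (f := π) fun a ha b hb hab => ?_
        have : a * b⁻¹ ∈ N := by
          rw [← hπ1, map_mul, map_inv, hab, mul_inv_cancel]
        exact mul_inv_eq_one.1 (hAS i _ (mul_mem ha (inv_mem hb)) (hNS this))
      exact (Nat.card_le_card_of_surjective _ (π.subgroupMap_surjective S)).trans
        ((hcard i).trans_eq h1.symm)
    · intro H hSH hAH
      have := hgen (H.comap π) (map_le_iff_le_comap.1 hSH) fun i => map_le_iff_le_comap.1 (hAH i)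
      rw [← map_comap_eq_self_of_surjective hπ H, this, map_top_of_surjective π hπ]
    · rintro i _ ⟨a, ha, rfl⟩ ha1 _ ⟨τ, hτ, rfl⟩
      obtain ⟨h, rfl⟩ := hcam i a ha (fun e => ha1 (by rw [e, map_one])) τ hτ
      exact ⟨π h, (map_commutatorElement π a h).symm⟩
    · rw [← commutator_top_left_eq_bot_iff_le_center, ← map_top_of_surjective π hπ,
        ← map_commutator, ← map_commutator, Subgroup.map_eq_bot_iff, QuotientGroup.ker_mk']
  have hMN : M ≤ N := by
    rw [hM, commutator_le]
    intro g _ σ hσ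
    rw [← hπ1, map_commutatorElement, commutatorElement_eq_one_iff_mul_comm]
    exact mem_center_iff.1 (key ⟨σ, hσ, rfl⟩) (π g)
  -- From `M ≤ [G, M]`, the subgroup `M` lies in every term of the lower central series, which
  -- reaches the trivial group.
  have hlcs : ∀ n, M ≤ (⊤ : Subgroup G).lowerCentralSeries n := by
    intro n
    induction n with
    | zero => exact le_top
    | succ n ih =>
      refine hMN.trans ?_
      rw [hN, commutator_comm]
      exact commutator_mono ih le_rfl
  rw [← commutator_top_left_eq_bot_iff_le_center, ← hM, eq_bot_iff]
  obtain ⟨n, hn⟩ := nilpotent_iff_lowerCentralSeries.1 ‹Group.IsNilpotent G›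
  exact hn ▸ hlcs n

end Subgroup

/-! ### The subgroup family of a skew translation quadrangle -/

namespace PointLineGeometry
variable {P L : Type*} {Γ : PointLineGeometry P L}

lemma Collinear.symm {p q : P} (h : Γ.Collinear p q) : Γ.Collinear q p :=
  let ⟨l, h1, h2⟩ := h
  ⟨l, h2, h1⟩

/-- An elation quadrangle with elation point `x`, in terms of an abstract group `G` acting on
the points and lines. -/
structure IsElationAction (Γ : PointLineGeometry P L) (x : P) (G : Type*) [Group G]
    [MulAction G P] [MulAction G L] (s t : ℕ) : Prop where
  quad : Γ.IsQuad
  two_le_s : 2 ≤ s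
  two_le_t : 2 ≤ t
  order : Γ.HasOrder s t
  inc_smul : ∀ (g : G) {p : P} {l : L}, Γ.Inc p l → Γ.Inc (g • p) (g • l)
  smul_line : ∀ (g : G) {l : L}, Γ.Inc x l → g • l = l
  exists_smul_eq : ∀ {y z : P}, ¬ Γ.Collinear x y → ¬ Γ.Collinear x z → ∃ g : G, g • y = z
  eq_one : ∀ {y : P} {g : G}, ¬ Γ.Collinear x y → g • y = y → g = 1

/-- A skew translation quadrangle with property (*) whose order is not `(t, t)` with `t` even,
in terms of an abstract group `G` acting on the points and lines. -/
structure IsSkewAction (Γ : PointLineGeometry P L) (x : P) (G : Type*) [Group G]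
    [MulAction G P] [MulAction G L] (s t : ℕ) : Prop extends IsElationAction Γ x G s t where
  not_even : s = t → ¬ Even t
  star : ∀ {g : G} {Y : L} {z w : P}, Γ.Inc x Y → Γ.Inc z Y → z ≠ x → g • z = z →
    Γ.Inc w Y → g • w = w
  regular : ∀ {y z u v w : P}, ¬ Γ.Collinear x y → u ≠ v → Γ.Collinear u x → Γ.Collinear u y →
    Γ.Collinear v x → Γ.Collinear v y → Γ.Collinear z u → Γ.Collinear z v →
    Γ.Collinear w x → Γ.Collinear w y → Γ.Collinear z w

/-- The line `M` joins `y` to the point `u` of the line `Y` on `x`. -/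
structure IsArm (Γ : PointLineGeometry P L) (x y : P) (Y : L) (u : P) (M : L) : Prop where
  base : Γ.Inc x Y
  left : Γ.Inc u Y
  right : Γ.Inc u M
  tip : Γ.Inc y M

section Arm
variable {x y : P} {Y Z M N : L} {u v : P}

lemma IsArm.ne (a : Γ.IsArm x y Y u M) (hy : ¬ Γ.Collinear x y) :
    u ≠ x := by
  rintro rfl
  exact hy ⟨M, a.right, a.tip⟩

lemma IsArm.tip_ne (a : Γ.IsArm x y Y u M) (hy : ¬ Γ.Collinear x y) :
    y ≠ u := by
  rintro rfl
  exact hy ⟨Y, a.base, a.left⟩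

lemma IsArm.not_inc (a : Γ.IsArm x y Y u M)
    (hy : ¬ Γ.Collinear x y) : ¬ Γ.Inc x M :=
  fun e => hy ⟨M, e, a.tip⟩

/-- The points of an arm other than its foot are not collinear with `x`. -/
lemma not_collinear_of_arm (h : Γ.IsQuad) (hy : ¬ Γ.Collinear x y)
    (a : Γ.IsArm x y Y u M) {z : P} (hz : Γ.Inc z M) (hzu : z ≠ u) : ¬ Γ.Collinear x z := by
  rintro ⟨W, h1, h2⟩
  exact hzu (h.proj_unique (a.not_inc hy) h1 h2 hz a.base a.left a.right).1

/-- The points of a line `Z` on `x` are not on the arms at other lines. -/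
lemma not_inc_arm (h : Γ.IsQuad) (hy : ¬ Γ.Collinear x y)
    (a : Γ.IsArm x y Y u M) (hZ : Γ.Inc x Z) (hYZ : Y ≠ Z) {w : P} (hw : Γ.Inc w Z) :
    ¬ Γ.Inc w M := by
  intro e
  exact hYZ (h.proj_unique (a.not_inc hy) a.base a.left a.right hZ hw e).2

end Arm

namespace IsElationAction
variable {x y : P} {G : Type*} [Group G] [MulAction G P] [MulAction G L] {s t : ℕ}
  {Y Z M N : L} {u v : P}

lemma exists_line (h : IsElationAction Γ x G s t) : ∃ Y, Γ.Inc x Y :=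
  Set.nonempty_of_ncard_ne_zero (s := Γ.linesOn x) (by rw [h.order.2]; omega)

lemma exists_arm (h : IsElationAction Γ x G s t) (hy : ¬ Γ.Collinear x y) {Y : L} (hY : Γ.Inc x Y) :
    ∃ u M, Γ.IsArm x y Y u M := by
  obtain ⟨u, M, h1, h2, h3⟩ := h.quad.exists_proj (p := y) (l := Y) fun e => hy ⟨Y, hY, e⟩
  exact ⟨u, M, hY, h3, h2, h1⟩

lemma exists_arm' (h : IsElationAction Γ x G s t) (hy : ¬ Γ.Collinear x y) {M : L}
    (hM : Γ.Inc y M) : ∃ Y u, Γ.IsArm x y Y u M := by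
  obtain ⟨u, Y, h1, h2, h3⟩ := h.quad.exists_proj (p := x) (l := M) fun e => hy ⟨M, e, hM⟩
  exact ⟨Y, u, h1, h2, h3, hM⟩

lemma exists_line_ne_ne [Finite L] (h : IsElationAction Γ x G s t) (Y Z : L) :
    ∃ W, Γ.Inc x W ∧ W ≠ Y ∧ W ≠ Z := by
  have h1 := h.order.2 x
  have h2 := h.two_le_t
  obtain ⟨W, hW, hW'⟩ := Set.exists_mem_notMem_of_ncard_lt_ncard
    (s := {Y, Z}) (t := Γ.linesOn x) ((Set.ncard_insert_le _ _).trans_lt (by simp; omega))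
  simp only [Set.mem_insert_iff, Set.mem_singleton_iff, not_or] at hW'
  exact ⟨W, hW, hW'.1, hW'.2⟩

lemma smul_base (h : IsElationAction Γ x G s t) (g : G) : g • x = x := by
  obtain ⟨Y, hY⟩ := h.exists_line
  obtain ⟨Z, hZY, hZ⟩ := h.quad.exists_line_ne Y x
  have h1 := h.inc_smul g hY
  have h2 := h.inc_smul g hZ
  rw [h.smul_line g hY] at h1
  rw [h.smul_line g hZ] at h2
  exact h.quad.point_unique hZY h2 h1 hZ hY

lemma smul_mem_line (h : IsElationAction Γ x G s t) (g : G) {z : P} (hY : Γ.Inc x Y)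
    (hz : Γ.Inc z Y) : Γ.Inc (g • z) Y := by
  have := h.inc_smul g hz
  rwa [h.smul_line g hY] at this

lemma not_collinear_smul [Finite L] (h : IsElationAction Γ x G s t) (g : G) {z : P}
    (hz : ¬ Γ.Collinear x z) : ¬ Γ.Collinear x (g • z) := by
  rintro ⟨W, h1, h2⟩
  refine hz ⟨W, h1, ?_⟩
  have := h.smul_mem_line g⁻¹ h1 h2
  rwa [inv_smul_smul] at this

/-- An element mapping `y` to a point joined by `N` to the point `w` of `Y` maps the foot at `Y`
to `w` and the arm at `Y` to `N`. -/
lemma smul_arm [Finite L] (h : IsElationAction Γ x G s t) (hy : ¬ Γ.Collinear x y)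
    (a : Γ.IsArm x y Y u M) {g : G} {w : P} (hN : Γ.Inc (g • y) N) (hw : Γ.Inc w N)
    (hw' : Γ.Inc w Y) : g • u = w ∧ g • M = N := by
  have h0 : ¬ Γ.Inc (g • y) Y := fun e => h.not_collinear_smul g hy ⟨Y, a.base, e⟩
  exact h.quad.proj_unique h0 (h.inc_smul g a.tip) (h.inc_smul g a.right)
    (h.smul_mem_line g a.base a.left) hN hw hw'

end IsElationAction

namespace IsSkewAction
variable {x y : P} {G : Type*} [Group G] [MulAction G P]

/-- The symmetries with center `x` in `G`. -/
abbrev symm (Γ : PointLineGeometry P L) (x : P) (G : Type*) [Group G] [MulAction G P] :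
    Subgroup G :=
  fixingSubgroup G {z | Γ.Collinear x z}

/-- The elements of `G` fixing all points of a line. -/
abbrev lineFixer (Γ : PointLineGeometry P L) (G : Type*) [Group G] [MulAction G P] (Y : L) :
    Subgroup G :=
  fixingSubgroup G (Γ.pointsOn Y)

lemma smul_eq_of_mem_lineFixer {g : G} {Y : L} (hg : g ∈ lineFixer Γ G Y) {z : P} (hz : Γ.Inc z Y) :
    g • z = z :=
  (mem_fixingSubgroup_iff G).1 hg z hz

lemma symm_le_lineFixer {Y : L} (hY : Γ.Inc x Y) : symm Γ x G ≤ lineFixer Γ G Y :=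
  fun _ hg => (mem_fixingSubgroup_iff G).2 fun z hz =>
    (mem_fixingSubgroup_iff G).1 hg z ⟨Y, hY, hz⟩

variable [MulAction G L] {s t : ℕ}

section Arm
variable {Y Z M N : L} {u v : P}

lemma mem_lineFixer (h : IsSkewAction Γ x G s t) {g : G} {z : P} (hY : Γ.Inc x Y)
    (hz : Γ.Inc z Y) (hzx : z ≠ x) (hg : g • z = z) : g ∈ lineFixer Γ G Y :=
  (mem_fixingSubgroup_iff G).2 fun _ hw => h.star hY hz hzx hg hw

lemma lineFixer_normal (h : IsSkewAction Γ x G s t) (hY : Γ.Inc x Y) :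
    (lineFixer Γ G Y).Normal := by
  refine ⟨fun n hn g => (mem_fixingSubgroup_iff G).2 fun z hz => ?_⟩
  rw [mul_smul, mul_smul, smul_eq_of_mem_lineFixer hn (h.smul_mem_line g⁻¹ hY hz), smul_inv_smul]

lemma symm_normal [Finite L] (h : IsSkewAction Γ x G s t) : (symm Γ x G).Normal := by
  refine ⟨fun n hn g => (mem_fixingSubgroup_iff G).2 fun z hz => ?_⟩
  obtain ⟨W, h1, h2⟩ := hz
  rw [mul_smul, mul_smul, (mem_fixingSubgroup_iff G).1 hn (g⁻¹ • z)
    ⟨W, h1, h.smul_mem_line g⁻¹ h1 h2⟩, smul_inv_smul]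

lemma stabilizer_le_lineFixer (h : IsSkewAction Γ x G s t) (hy : ¬ Γ.Collinear x y)
    (a : Γ.IsArm x y Y u M) : MulAction.stabilizer G M ≤ lineFixer Γ G Y := by
  intro g hg
  rw [MulAction.mem_stabilizer_iff] at hg
  have hYM : Y ≠ M := fun e => a.not_inc hy (e ▸ a.base)
  have h1 := h.inc_smul g a.right
  rw [hg] at h1
  exact h.mem_lineFixer a.base a.left (a.ne hy)
    (h.quad.point_unique hYM (h.smul_mem_line g a.base a.left) h1 a.left a.right)

/-- The point `y` is the projection on `M` of its foot on `Z`. An element fixing `M` and this foot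
therefore fixes `y`, and the action is sharply transitive. -/
lemma eq_one_of_mem_stabilizer (h : IsSkewAction Γ x G s t) (hy : ¬ Γ.Collinear x y)
    (a : Γ.IsArm x y Y u M) (hZ : Γ.Inc x Z) (hYZ : Y ≠ Z) {g : G}
    (hg : g ∈ MulAction.stabilizer G M) (hg' : g ∈ lineFixer Γ G Z) : g = 1 := by
  rw [MulAction.mem_stabilizer_iff] at hg
  obtain ⟨v, N, b⟩ := h.exists_arm hy hZ
  have h1 := h.inc_smul g b.right
  rw [smul_eq_of_mem_lineFixer hg' b.left] at h1
  have h2 := h.inc_smul g a.tip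
  rw [hg] at h2
  exact h.eq_one hy (h.quad.proj_unique (not_inc_arm h.quad hy a hZ hYZ b.left) h1
    (h.inc_smul g b.tip) h2 b.right b.tip a.tip).1

lemma exists_stabilizer_smul_eq [Finite L] (h : IsSkewAction Γ x G s t)
    (hy : ¬ Γ.Collinear x y) (a : Γ.IsArm x y Y u M) {z : P} (hz : Γ.Inc z M) (hzu : z ≠ u) :
    ∃ g ∈ MulAction.stabilizer G M, g • y = z := by
  obtain ⟨g, rfl⟩ := h.exists_smul_eq hy (not_collinear_of_arm h.quad hy a hz hzu)
  exact ⟨g, (h.smul_arm hy a hz a.right a.left).2, rfl⟩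

/-- This is the factorization `G = A_M A*_Z`. The image under `g` of the foot `v` on `Z` projects to
a point of `M` other than `u`, and the element of `A_M` that moves `y` to this point agrees with `g`
on `v`. -/
lemma exists_stabilizer_mul [Finite L] (h : IsSkewAction Γ x G s t) (hy : ¬ Γ.Collinear x y)
    (a : Γ.IsArm x y Y u M) (hZ : Γ.Inc x Z) (hYZ : Y ≠ Z) (g : G) :
    ∃ k ∈ MulAction.stabilizer G M, k⁻¹ * g ∈ lineFixer Γ G Z := by
  obtain ⟨v, N, b⟩ := h.exists_arm hy hZ
  have hwZ : Γ.Inc (g • v) Z := h.smul_mem_line g hZ b.left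
  have hwx : g • v ≠ x := by
    intro e
    apply b.ne hy
    rw [← h.smul_base g] at e
    exact MulAction.injective g e
  obtain ⟨z, N', h1, h2, h3⟩ := h.quad.exists_proj (not_inc_arm h.quad hy a hZ hYZ hwZ)
  have hzu : z ≠ u := by
    rintro rfl
    have h0 : ¬ Γ.Inc x N' := by
      intro e
      have e1 := h.quad.line_unique (a.ne hy) a.left a.base h2 e
      have e2 := h.quad.line_unique hwx hwZ hZ h1 e
      exact hYZ (e1.trans e2.symm)
    exact hYZ (h.quad.proj_unique h0 a.base a.left h2 hZ hwZ h1).2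
  obtain ⟨k, hk, rfl⟩ := h.exists_stabilizer_smul_eq hy a h3 hzu
  refine ⟨k, hk, h.mem_lineFixer hZ b.left (b.ne hy) ?_⟩
  rw [mul_smul, inv_smul_eq_iff]
  exact (h.smul_arm hy b h2 h1 hwZ).1.symm

/-- Here regularity enters: `g • y` is collinear with two points of the trace `{x, y}^⊥`, hence with
all of them. So `g` fixes a point other than `x` on every line through `x`, and by (*) every point
of that line. -/
lemma mem_symm_of_mem_lineFixer [Finite L] (h : IsSkewAction Γ x G s t)
    (hy : ¬ Γ.Collinear x y) (hY : Γ.Inc x Y) (hZ : Γ.Inc x Z) (hYZ : Y ≠ Z) {g : G}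
    (hgY : g ∈ lineFixer Γ G Y) (hgZ : g ∈ lineFixer Γ G Z) : g ∈ symm Γ x G := by
  obtain ⟨u, M, a⟩ := h.exists_arm hy hY
  obtain ⟨v, N, b⟩ := h.exists_arm hy hZ
  refine (mem_fixingSubgroup_iff G).2 ?_
  rintro w ⟨W, hW, hwW⟩
  obtain ⟨w', N', c⟩ := h.exists_arm hy hW
  have huv : u ≠ v := by
    rintro rfl
    exact hYZ (h.quad.line_unique (a.ne hy) a.left hY b.left hZ)
  have h1 := h.inc_smul g a.right
  rw [smul_eq_of_mem_lineFixer hgY a.left] at h1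
  have h2 := h.inc_smul g b.right
  rw [smul_eq_of_mem_lineFixer hgZ b.left] at h2
  obtain ⟨K, hK1, hK2⟩ := h.regular (z := g • y) (w := w') hy huv ⟨Y, a.left, hY⟩
    ⟨M, a.right, a.tip⟩ ⟨Z, b.left, hZ⟩ ⟨N, b.right, b.tip⟩
    ⟨g • M, h.inc_smul g a.tip, h1⟩ ⟨g • N, h.inc_smul g b.tip, h2⟩
    ⟨W, c.left, hW⟩ ⟨N', c.right, c.tip⟩
  exact h.star hW c.left (c.ne hy) (h.smul_arm hy c hK1 hK2 c.left).1 hwW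

lemma eq_one_of_mem_stabilizer_of_mem_symm [Finite L] (h : IsSkewAction Γ x G s t)
    (hy : ¬ Γ.Collinear x y) (a : Γ.IsArm x y Y u M) {g : G}
    (hg : g ∈ MulAction.stabilizer G M) (hg' : g ∈ symm Γ x G) : g = 1 := by
  obtain ⟨Z, hZ, hZY, -⟩ := h.exists_line_ne_ne Y Y
  exact h.eq_one_of_mem_stabilizer hy a hZ hZY.symm hg (symm_le_lineFixer hZ hg')

lemma exists_stabilizer_mul_symm [Finite L] (h : IsSkewAction Γ x G s t)
    (hy : ¬ Γ.Collinear x y) (a : Γ.IsArm x y Y u M) {g : G} (hg : g ∈ lineFixer Γ G Y) :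
    ∃ k ∈ MulAction.stabilizer G M, k⁻¹ * g ∈ symm Γ x G := by
  obtain ⟨Z, hZ, hZY, -⟩ := h.exists_line_ne_ne Y Y
  obtain ⟨k, hk, hkg⟩ := h.exists_stabilizer_mul hy a hZ hZY.symm g
  exact ⟨k, hk, h.mem_symm_of_mem_lineFixer hy a.base hZ hZY.symm
    (mul_mem (inv_mem (h.stabilizer_le_lineFixer hy a hk)) hg) hkg⟩

/-- The symmetries are transitive on the lines on `u` different from `Y`. -/
lemma exists_symm_smul_line_eq [Finite L] (h : IsSkewAction Γ x G s t)
    (hy : ¬ Γ.Collinear x y) (a : Γ.IsArm x y Y u M) (hN : Γ.Inc u N) (hNY : N ≠ Y) :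
    ∃ g ∈ symm Γ x G, g • M = N := by
  obtain ⟨Z, hZ, hZY, -⟩ := h.exists_line_ne_ne Y Y
  obtain ⟨v, K, b⟩ := h.exists_arm hy hZ
  have hxN : ¬ Γ.Inc x N := fun e => hNY (h.quad.line_unique (a.ne hy) hN e a.left a.base)
  have hvN : ¬ Γ.Inc v N := fun e =>
    hZY (h.quad.proj_unique hxN hZ b.left e a.base a.left hN).2
  obtain ⟨z, K', h1, h2, h3⟩ := h.quad.exists_proj hvN
  have hzu : z ≠ u := by
    rintro rfl
    have h0 : ¬ Γ.Inc x K' := by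
      intro e
      have e1 := h.quad.line_unique (a.ne hy) a.left a.base h2 e
      have e2 := h.quad.line_unique (b.ne hy) b.left hZ h1 e
      exact hZY (e2.trans e1.symm)
    exact hZY (h.quad.proj_unique h0 hZ b.left h1 a.base a.left h2).2
  have hxz : ¬ Γ.Collinear x z := by
    rintro ⟨W, h4, h5⟩
    exact hzu (h.quad.proj_unique hxN h4 h5 h3 a.base a.left hN).1
  -- The point `z` of `N` was chosen collinear with the foot `v` on a second line `Z`, so an element
  -- moving `y` to `z` fixes both feet `u` and `v` and is a symmetry.
  obtain ⟨g, rfl⟩ := h.exists_smul_eq hy hxz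
  have e1 := h.smul_arm hy a h3 hN a.left
  have e2 := h.smul_arm hy b h2 h1 b.left
  exact ⟨g, h.mem_symm_of_mem_lineFixer hy a.base hZ hZY.symm
    (h.mem_lineFixer a.base a.left (a.ne hy) e1.1)
    (h.mem_lineFixer hZ b.left (b.ne hy) e2.1), e1.2⟩

lemma card_stabilizer [Finite P] [Finite L] (h : IsSkewAction Γ x G s t)
    (hy : ¬ Γ.Collinear x y) (a : Γ.IsArm x y Y u M) :
    Nat.card (MulAction.stabilizer G M) = s := by
  have h1 : (Γ.pointsOn M \ {u}).ncard = s := by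
    rw [Set.ncard_sdiff_singleton_of_mem (s := Γ.pointsOn M) a.right, h.order.1, Nat.add_sub_cancel]
  rw [← h1]
  refine Nat.card_congr (Equiv.ofBijective (fun g => ⟨(g : G) • y, ?_, ?_⟩) ⟨?_, ?_⟩)
  · have := h.inc_smul (g : G) a.tip
    rwa [MulAction.mem_stabilizer_iff.1 g.2] at this
  · intro e
    exact h.not_collinear_smul (g : G) hy
      ⟨Y, a.base, (Set.mem_singleton_iff.1 e) ▸ a.left⟩
  · intro g k hgk
    have := congrArg Subtype.val hgk
    have e := h.eq_one (g := (k : G)⁻¹ * g) hy (by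
      rw [mul_smul, inv_smul_eq_iff]; exact this)
    exact Subtype.ext (inv_mul_eq_one.1 e).symm
  · rintro ⟨z, hz, hzu⟩
    obtain ⟨g, hg, rfl⟩ := h.exists_stabilizer_smul_eq hy a hz hzu
    exact ⟨⟨g, hg⟩, rfl⟩

lemma card_symm [Finite L] (h : IsSkewAction Γ x G s t)
    (hy : ¬ Γ.Collinear x y) : Nat.card (symm Γ x G) = t := by
  obtain ⟨Y, hY⟩ := h.exists_line
  obtain ⟨u, M, a⟩ := h.exists_arm hy hY
  have h1 : (Γ.linesOn u \ {Y}).ncard = t := by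
    rw [Set.ncard_sdiff_singleton_of_mem (s := Γ.linesOn u) a.left, h.order.2, Nat.add_sub_cancel]
  have hu : ∀ g ∈ symm Γ x G, g • u = u := fun g hg =>
    (mem_fixingSubgroup_iff G).1 hg u ⟨Y, hY, a.left⟩
  rw [← h1]
  refine Nat.card_congr (Equiv.ofBijective (fun g => ⟨(g : G) • M, ?_, ?_⟩) ⟨?_, ?_⟩)
  · have := h.inc_smul (g : G) a.right
    rwa [hu _ g.2] at this
  · intro e
    rw [Set.mem_singleton_iff, smul_eq_iff_eq_inv_smul, h.smul_line _ hY] at e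
    exact a.not_inc hy (e ▸ hY)
  · intro g k hgk
    have := congrArg Subtype.val hgk
    have e := h.eq_one_of_mem_stabilizer_of_mem_symm hy a (g := (k : G)⁻¹ * g) (by
      rw [MulAction.mem_stabilizer_iff, mul_smul, inv_smul_eq_iff]; exact this)
      (mul_mem (inv_mem k.2) g.2)
    exact Subtype.ext (inv_mul_eq_one.1 e).symm
  · rintro ⟨N, hN, hNY⟩
    obtain ⟨g, hg, rfl⟩ := h.exists_symm_smul_line_eq hy a hN hNY
    exact ⟨⟨g, hg⟩, rfl⟩

/-- Every element factors uniquely as a product from `A_M`, `A_N` and `S`, for arms `M`, `N` at two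
different lines on `x`. -/
lemma card_eq [Finite P] [Finite L] (h : IsSkewAction Γ x G s t)
    (hy : ¬ Γ.Collinear x y) : Nat.card G = s * (s * t) := by
  obtain ⟨Y, hY⟩ := h.exists_line
  obtain ⟨Z, hZY, hZ⟩ := h.quad.exists_line_ne Y x
  obtain ⟨u, M, a⟩ := h.exists_arm hy hY
  obtain ⟨v, N, b⟩ := h.exists_arm hy hZ
  rw [← h.card_stabilizer hy a, ← h.card_symm hy]
  nth_rewrite 2 [h.card_stabilizer hy a]
  rw [← h.card_stabilizer hy b, ← Nat.card_prod, ← Nat.card_prod]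
  refine (Nat.card_congr (Equiv.ofBijective (fun k => (k.1 : G) * ((k.2.1 : G) * (k.2.2 : G)))
    ⟨?_, ?_⟩)).symm
  · rintro ⟨⟨k, hk⟩, ⟨m, hm⟩, ⟨σ, hσ⟩⟩ ⟨⟨k', hk'⟩, ⟨m', hm'⟩, ⟨σ', hσ'⟩⟩ e
    simp only at e
    have h1 : k'⁻¹ * k = 1 := by
      refine h.eq_one_of_mem_stabilizer hy a hZ hZY.symm (mul_mem (inv_mem hk') hk) ?_
      have : k'⁻¹ * k = (m' * σ') * (m * σ)⁻¹ := by
        rw [eq_mul_inv_iff_mul_eq, mul_assoc, e, inv_mul_cancel_left]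
      rw [this]
      have hK := h.stabilizer_le_lineFixer hy b
      have hS := symm_le_lineFixer (G := G) hZ
      exact mul_mem (mul_mem (hK hm') (hS hσ')) (inv_mem (mul_mem (hK hm) (hS hσ)))
    obtain rfl := inv_mul_eq_one.1 h1
    have e' := mul_left_cancel e
    have h2 : m'⁻¹ * m = 1 := by
      refine h.eq_one_of_mem_stabilizer_of_mem_symm hy b (mul_mem (inv_mem hm') hm) ?_
      have : m'⁻¹ * m = σ' * σ⁻¹ := by
        rw [eq_mul_inv_iff_mul_eq, mul_assoc, e', inv_mul_cancel_left]
      rw [this]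
      exact mul_mem hσ' (inv_mem hσ)
    obtain rfl := inv_mul_eq_one.1 h2
    obtain rfl := mul_left_cancel e'
    rfl
  · intro g
    obtain ⟨k, hk, hkg⟩ := h.exists_stabilizer_mul hy a hZ hZY.symm g
    obtain ⟨m, hm, hmg⟩ := h.exists_stabilizer_mul_symm hy b hkg
    exact ⟨⟨⟨k, hk⟩, ⟨m, hm⟩, ⟨_, hmg⟩⟩, by simp⟩

open scoped commutatorElement

/-- Normal subgroups `A*_Y` and `A*_Z` with intersection in `S` commute modulo `S`. As `x` is on at
least three lines, each `A*_W` commutes modulo `S` with two further factors `A_M` and `A*_Z` of `G`,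
so it is central modulo `S`; finally `G` is a product of such subgroups. -/
lemma commutator_mem_symm [Finite L] (h : IsSkewAction Γ x G s t)
    (hy : ¬ Γ.Collinear x y) (g k : G) : ⁅g, k⁆ ∈ symm Γ x G := by
  have := h.symm_normal
  let π := QuotientGroup.mk' (symm Γ x G)
  have hπ : ∀ {g}, π g = 1 ↔ g ∈ symm Γ x G := fun {g} => QuotientGroup.eq_one_iff g
  have h1 : ∀ {Y Z}, Γ.Inc x Y → Γ.Inc x Z → Y ≠ Z → ∀ g ∈ lineFixer Γ G Y,
      ∀ k ∈ lineFixer Γ G Z, Commute (π g) (π k) := by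
    intro Y Z hY hZ hYZ g hg k hk
    rw [← commutatorElement_eq_one_iff_commute, ← map_commutatorElement, hπ]
    have := h.lineFixer_normal hY
    have := h.lineFixer_normal hZ
    have hmem := Subgroup.commutator_le_inf _ _ (Subgroup.commutator_mem_commutator hg hk)
    exact h.mem_symm_of_mem_lineFixer hy hY hZ hYZ hmem.1 hmem.2
  have h2 : ∀ {W}, Γ.Inc x W → ∀ g ∈ lineFixer Γ G W, ∀ k, Commute (π g) (π k) := by
    intro W hW g hg k
    obtain ⟨Y, hY, hYW, -⟩ := h.exists_line_ne_ne W W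
    obtain ⟨Z, hZ, hZW, hZY⟩ := h.exists_line_ne_ne W Y
    obtain ⟨u, M, a⟩ := h.exists_arm hy hY
    obtain ⟨m, hm, hmk⟩ := h.exists_stabilizer_mul hy a hZ hZY.symm k
    have := (h1 hW hY hYW.symm g hg m (h.stabilizer_le_lineFixer hy a hm)).mul_right
      (h1 hW hZ hZW.symm g hg _ hmk)
    rwa [← map_mul, mul_inv_cancel_left] at this
  rw [← hπ, map_commutatorElement, commutatorElement_eq_one_iff_commute]
  obtain ⟨Y, hY⟩ := h.exists_line
  obtain ⟨Z, hZY, hZ⟩ := h.quad.exists_line_ne Y x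
  obtain ⟨u, M, a⟩ := h.exists_arm hy hY
  obtain ⟨m, hm, hmg⟩ := h.exists_stabilizer_mul hy a hZ hZY.symm g
  have := (h2 hY m (h.stabilizer_le_lineFixer hy a hm) k).mul_left (h2 hZ _ hmg k)
  rwa [← map_mul, mul_inv_cancel_left] at this

lemma stabilizer_mul_comm [Finite L] (h : IsSkewAction Γ x G s t)
    (hy : ¬ Γ.Collinear x y) (a : Γ.IsArm x y Y u M) (g : G)
    (hg : g ∈ MulAction.stabilizer G M) (k : G) (hk : k ∈ MulAction.stabilizer G M) :
    g * k = k * g := by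
  rw [← commutatorElement_eq_one_iff_mul_comm]
  refine h.eq_one_of_mem_stabilizer_of_mem_symm hy a ?_ (h.commutator_mem_symm hy g k)
  rw [commutatorElement_def]
  exact mul_mem (mul_mem (mul_mem hg hk) (inv_mem hg)) (inv_mem hk)

end Arm
end IsSkewAction
end PointLineGeometry

/-! ### Arithmetic of the order -/

/-- The parameters of a skew translation quadrangle with property (*) satisfy `s + t ∤ s * t`. -/
lemma not_add_dvd_mul {s t : ℕ} (hs : 2 ≤ s) (ht : 2 ≤ t) (hst : t ≤ s)
    (hp : ∀ p, p.Prime → p ∣ s → ∃ k, t ≤ p ^ k ∧ p ^ k ∣ s) (hne : s = t → ¬ Even t) :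
    ¬ s + t ∣ s * t := by
  intro hdvd
  -- The quotient of `s * t` by `s + t` is less than `t`, say `t - e` with `e ≥ 1`; then `e * (s +
  -- t) = t * t`.
  have hlt : s < t * t := by
    obtain ⟨k, hk⟩ := hdvd
    have h1 : k < t := by
      by_contra! hle
      nlinarith
    obtain ⟨d, rfl⟩ := Nat.exists_eq_add_of_lt h1
    nlinarith
  -- Two primes would give coprime divisors of `s`, both at least `t`, against `s < t * t`.
  have huniq : ∀ p q, p.Prime → q.Prime → p ∣ s → q ∣ s → p = q := by
    intro p q hpp hqq hps hqs
    by_contra hpq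
    obtain ⟨k, hk, hk'⟩ := hp p hpp hps
    obtain ⟨m, hm, hm'⟩ := hp q hqq hqs
    have hco : Nat.Coprime (p ^ k) (q ^ m) :=
      Nat.Coprime.pow _ _ ((Nat.coprime_primes hpp hqq).2 hpq)
    have := Nat.le_of_dvd (by omega) (hco.mul_dvd_of_dvd_of_dvd hk' hm')
    have := Nat.mul_le_mul hk hm
    omega
  have hg : 0 < Nat.gcd s t := Nat.gcd_pos_of_pos_left _ (by omega)
  obtain ⟨a, ha⟩ := Nat.gcd_dvd_left s t
  obtain ⟨b, hb⟩ := Nat.gcd_dvd_right s t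
  have hab : Nat.Coprime a b := by
    have := Nat.coprime_div_gcd_div_gcd hg
    rwa [Nat.div_eq_of_eq_mul_right hg ha, Nat.div_eq_of_eq_mul_right hg hb] at this
  set g := Nat.gcd s t with hgdef
  have h1 : a + b ∣ g := by
    have h2 : g * (a + b) ∣ g * (a * b * g) := by
      have : g * (a * b * g) = s * t := by rw [ha, hb]; ring
      rw [this, mul_add, ← ha, ← hb]
      exact hdvd
    have h3 := Nat.dvd_of_mul_dvd_mul_left hg h2
    have h4 : Nat.Coprime (a + b) (a * b) :=
      Nat.Coprime.mul_right (by simpa [Nat.coprime_comm] using hab) (by simpa using hab)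
    exact h4.dvd_of_dvd_mul_left h3
  have ha0 : a ≠ 0 := by rintro rfl; omega
  have hb0 : b ≠ 0 := by rintro rfl; omega
  -- Both `a` and `a + b` divide `s`. If `a ≠ 1`, the single prime dividing `s` divides both,
  -- against the coprimality of `a` and `b`. With `a = 1`, the inequality `t ≤ s` forces `b = 1`,
  -- and `a + b ∣ g` makes `t = g` even.
  have ha1 : a = 1 := by
    by_contra ha1
    obtain ⟨p, hpp, hpa⟩ := Nat.exists_prime_and_dvd ha1
    obtain ⟨q, hqq, hqab⟩ := Nat.exists_prime_and_dvd (n := a + b) (by omega)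
    have hpq : p = q := huniq p q hpp hqq (hpa.trans ⟨g, by rw [mul_comm, ← ha]⟩)
      ((hqab.trans h1).trans ⟨a, ha⟩)
    subst hpq
    have hpb : p ∣ b := (Nat.dvd_add_right hpa).1 hqab
    exact hpp.one_lt.ne' (Nat.dvd_one.1 (hab ▸ Nat.dvd_gcd hpa hpb))
  have hb1 : b = 1 := by
    rw [ha1, mul_one] at ha
    have : g * b ≤ g * 1 := by rw [← hb, mul_one, ← ha]; exact hst
    have := Nat.le_of_mul_le_mul_left this hg
    omega
  subst ha1 hb1
  refine hne (by rw [ha, hb]) ?_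
  rw [hb, mul_one]
  exact even_iff_two_dvd.2 h1

lemma Set.ncard_sigma_eq_mul {α β : Type*} [Finite α] [Finite β] (A : Set α) (B : α → Set β)
    (n : ℕ) (hB : ∀ a ∈ A, (B a).ncard = n) :
    {ab : α × β | ab.1 ∈ A ∧ ab.2 ∈ B ab.1}.ncard = A.ncard * n := by
  have := Fintype.ofFinite A
  have e : {ab : α × β | ab.1 ∈ A ∧ ab.2 ∈ B ab.1} ≃ Σ a : A, B a :=
    { toFun := fun z => ⟨⟨z.1.1, z.2.1⟩, ⟨z.1.2, z.2.2⟩⟩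
      invFun := fun z => ⟨(z.1.1, z.2.1), z.1.2, z.2.2⟩
      left_inv := fun _ => rfl
      right_inv := fun _ => rfl }
  rw [← Nat.card_coe_set_eq, Nat.card_congr e, Nat.card_sigma,
    Finset.sum_congr rfl (g := fun _ => n) fun a _ => by rw [Nat.card_coe_set_eq, hB a a.2]]
  rw [Finset.sum_const, Finset.card_univ, smul_eq_mul, ← Nat.card_eq_fintype_card,
    Nat.card_coe_set_eq]

/-! ### Conjugacy in cosets of the symmetry group, and centrality -/

namespace PointLineGeometry.IsSkewAction
variable {P L : Type*} {Γ : PointLineGeometry P L} {x y : P} {G : Type*} [Group G]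
  [MulAction G P] [MulAction G L] {s t : ℕ} {Y Z M N : L} {u v : P}

open scoped commutatorElement

/-- The elements of the stabilizer of an arm whose order divides `p`. -/
def torsion [Finite L] (h : IsSkewAction Γ x G s t) (hy : ¬ Γ.Collinear x y)
    (a : Γ.IsArm x y Y u M) (p : ℕ) : Subgroup G where
  carrier := {g | g ∈ MulAction.stabilizer G M ∧ g ^ p = 1}
  mul_mem' := by
    rintro g k ⟨hg, hg'⟩ ⟨hk, hk'⟩
    have hc : Commute g k := h.stabilizer_mul_comm hy a g hg k hk
    exact ⟨mul_mem hg hk, by rw [hc.mul_pow, hg', hk', one_mul]⟩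
  one_mem' := ⟨one_mem _, one_pow _⟩
  inv_mem' := by
    rintro g ⟨hg, hg'⟩
    exact ⟨inv_mem hg, by rw [inv_pow, hg', inv_one]⟩

lemma mem_torsion [Finite L] (h : IsSkewAction Γ x G s t) (hy : ¬ Γ.Collinear x y)
    (a : Γ.IsArm x y Y u M) {p : ℕ} {g : G} :
    g ∈ h.torsion hy a p ↔ g ∈ MulAction.stabilizer G M ∧ g ^ p = 1 := Iff.rfl

lemma mul_pow_mem_symm [Finite L] (h : IsSkewAction Γ x G s t) (hy : ¬ Γ.Collinear x y)
    (g k : G) (n : ℕ) : (g ^ n * k ^ n)⁻¹ * (g * k) ^ n ∈ symm Γ x G := by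
  have := h.symm_normal
  let π := QuotientGroup.mk' (symm Γ x G)
  have hπ : ∀ {g}, π g = 1 ↔ g ∈ symm Γ x G := fun {g} => QuotientGroup.eq_one_iff g
  have hc : Commute (π g) (π k) := by
    rw [← commutatorElement_eq_one_iff_commute, ← map_commutatorElement, hπ]
    exact h.commutator_mem_symm hy g k
  rw [← hπ, map_mul, map_inv, map_pow, map_mul, map_mul, hc.mul_pow, map_pow, map_pow,
    inv_mul_cancel]

/-- Take `g` of order `p` in the stabilizer of an arm at another line. Each of the `t` lines `W ≠ Y`
on `x` yields `k` in `A_M` with `g * k` in `A*_W`. Since `G/S` is abelian, `k ^ p` lies in `A*_W`,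
so it is trivial. If two lines shared the same `k`, then `g * k` would be a symmetry and `g` would
fix `Y` pointwise, against `g ≠ 1`. -/
lemma le_card_torsion [Finite G] [Finite P] [Finite L] (h : IsSkewAction Γ x G s t)
    (hy : ¬ Γ.Collinear x y)
    (a : Γ.IsArm x y Y u M) {p : ℕ} (hp : p.Prime) (hps : p ∣ s) :
    t ≤ Nat.card (h.torsion hy a p) := by
  obtain ⟨Z, hZ, hZY, -⟩ := h.exists_line_ne_ne Y Y
  obtain ⟨v, N, b⟩ := h.exists_arm hy hZ
  have := Fact.mk hp
  obtain ⟨⟨g, hg⟩, hgp⟩ := exists_prime_orderOf_dvd_card' (G := MulAction.stabilizer G N) p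
    (by rwa [h.card_stabilizer hy b])
  rw [Subgroup.orderOf_mk] at hgp
  have hg1 : g ≠ 1 := by
    rintro rfl
    rw [orderOf_one] at hgp
    exact hp.one_lt.ne hgp
  have hgpow : g ^ p = 1 := hgp ▸ pow_orderOf_eq_one g
  have hex : ∀ W, W ∈ Γ.linesOn x \ {Y} → ∃ k ∈ h.torsion hy a p, g * k ∈ lineFixer Γ G W := by
    rintro W ⟨hW, hWY⟩
    obtain ⟨k, hk, hkg⟩ := h.exists_stabilizer_mul hy a hW (Ne.symm hWY) g⁻¹
    rw [← mul_inv_rev, Subgroup.inv_mem_iff] at hkg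
    refine ⟨k, ⟨hk, ?_⟩, hkg⟩
    refine h.eq_one_of_mem_stabilizer hy a hW (Ne.symm hWY) (pow_mem hk p) ?_
    have h1 := symm_le_lineFixer hW (h.mul_pow_mem_symm hy g k p)
    rw [hgpow, one_mul] at h1
    have h2 := mul_mem h1 (inv_mem (pow_mem hkg p))
    rwa [mul_inv_cancel_right, Subgroup.inv_mem_iff] at h2
  choose f hf hf' using hex
  have h1 : (Γ.linesOn x \ {Y}).ncard = t := by
    rw [Set.ncard_sdiff_singleton_of_mem (s := Γ.linesOn x) a.base, h.order.2,
      Nat.add_sub_cancel]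
  refine (h1.symm.trans (Nat.card_coe_set_eq _).symm).trans_le ?_
  refine Nat.card_le_card_of_injective (fun W => ⟨f W.1 W.2, hf W.1 W.2⟩) ?_
  intro W V hWV
  have e : f W.1 W.2 = f V.1 V.2 := congrArg Subtype.val hWV
  by_contra hne
  have hS : g * f W.1 W.2 ∈ symm Γ x G := h.mem_symm_of_mem_lineFixer hy W.2.1 V.2.1
    (fun e => hne (Subtype.ext e)) (hf' _ _) (e ▸ hf' _ _)
  have hgY := mul_mem (symm_le_lineFixer a.base hS)
    (inv_mem (h.stabilizer_le_lineFixer hy a (hf W.1 W.2).1))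
  rw [mul_inv_cancel_right] at hgY
  exact hg1 (h.eq_one_of_mem_stabilizer hy b a.base hZY hg hgY)

lemma exists_le_pow [Finite G] [Finite P] [Finite L] (h : IsSkewAction Γ x G s t)
    (hy : ¬ Γ.Collinear x y) {p : ℕ} (hp : p.Prime) (hps : p ∣ s) :
    ∃ k, t ≤ p ^ k ∧ p ^ k ∣ s := by
  obtain ⟨Y, hY⟩ := h.exists_line
  obtain ⟨u, M, a⟩ := h.exists_arm hy hY
  have := Fact.mk hp
  have hT : IsPGroup p (h.torsion hy a p) := fun g => ⟨1, Subtype.ext (by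
    simpa using ((h.mem_torsion hy a).1 g.2).2)⟩
  obtain ⟨k, hk⟩ := IsPGroup.iff_card.1 hT
  refine ⟨k, hk ▸ h.le_card_torsion hy a hp hps, ?_⟩
  rw [← hk]
  exact (Subgroup.card_dvd_of_le fun g hg => ((h.mem_torsion hy a).1 hg).1).trans
    (h.card_stabilizer hy a).dvd

lemma le [Finite G] [Finite P] [Finite L] (h : IsSkewAction Γ x G s t)
    (hy : ¬ Γ.Collinear x y) : t ≤ s := by
  have hs := h.two_le_s
  obtain ⟨k, hk, hk'⟩ := h.exists_le_pow hy (Nat.minFac_prime (by omega)) (Nat.minFac_dvd s)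
  exact hk.trans (Nat.le_of_dvd (by omega) hk')

lemma not_dvd [Finite G] [Finite P] [Finite L] (h : IsSkewAction Γ x G s t)
    (hy : ¬ Γ.Collinear x y) : ¬ s + t ∣ s * t := by
  exact not_add_dvd_mul h.two_le_s h.two_le_t (h.le hy)
    (fun _ hp hps => h.exists_le_pow hy hp hps) h.not_even

/-- The nontrivial elements of the stabilizer of an arm are conjugate to all elements of their
coset of the symmetry group. -/
lemma exists_conj_eq [Finite G] [Finite P] [Finite L] (h : IsSkewAction Γ x G s t)
    (hy : ¬ Γ.Collinear x y) (a : Γ.IsArm x y Y u M) {k σ : G}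
    (hk : k ∈ MulAction.stabilizer G M) (hk1 : k ≠ 1) (hσ : σ ∈ symm Γ x G) :
    ∃ c : G, c * k * c⁻¹ = k * σ := by
  set g := k * σ with hg
  have hgY : g ∈ lineFixer Γ G Y :=
    mul_mem (h.stabilizer_le_lineFixer hy a hk) (symm_le_lineFixer a.base hσ)
  have hgS : g ∉ symm Γ x G := fun e => hk1 (h.eq_one_of_mem_stabilizer_of_mem_symm hy a hk
    ((Subgroup.mul_mem_cancel_right _ hσ).1 e))
  -- Such a conjugate is congruent to `k` modulo `S`, and `A_M` meets `S` trivially, so it equals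
  -- `k`.
  suffices ∃ c : G, c⁻¹ * g * c ∈ MulAction.stabilizer G M by
    obtain ⟨c, hc⟩ := this
    have h1 : (c⁻¹ * g * c) * k⁻¹ = 1 := by
      refine h.eq_one_of_mem_stabilizer_of_mem_symm hy a (mul_mem hc (inv_mem hk)) ?_
      have := h.symm_normal
      have h2 := mul_mem (h.commutator_mem_symm hy c⁻¹ g) (this.conj_mem σ hσ k)
      have h3 : ⁅c⁻¹, g⁆ * (k * σ * k⁻¹) = c⁻¹ * g * c * k⁻¹ := by
        rw [commutatorElement_def, hg]; group
      rwa [h3] at h2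
    rw [mul_inv_eq_one] at h1
    exact ⟨c, by rw [← h1]; group⟩
  by_contra! hno
  -- If no conjugate of `g` is in `A_M`, the only flags counted by Benson's congruence are those
  -- with point on `Y`, and those with line on `x` other than `Y` and point other than `x`.
  have hcard : {zl : P × L | Γ.Inc zl.1 zl.2 ∧ Γ.Inc (g • zl.1) zl.2}.ncard =
      (s + 1) * (t + 1) + t * s := by
    have hset : {zl : P × L | Γ.Inc zl.1 zl.2 ∧ Γ.Inc (g • zl.1) zl.2} =
        {zl : P × L | zl.1 ∈ Γ.pointsOn Y ∧ zl.2 ∈ Γ.linesOn zl.1} ∪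
        Prod.swap '' {lz : L × P | lz.1 ∈ Γ.linesOn x \ {Y} ∧ lz.2 ∈ Γ.pointsOn lz.1 \ {x}} := by
      rw [Set.image_swap_eq_preimage_swap]
      ext ⟨z, l⟩
      simp only [Set.mem_ofPred_eq, Set.mem_union, Set.mem_preimage, Prod.swap_prod_mk,
        pointsOn, linesOn, Set.mem_sdiff, Set.mem_singleton_iff]
      constructor
      · rintro ⟨hz, hgz⟩
        by_cases hzY : Γ.Inc z Y
        · exact Or.inl ⟨hzY, hz⟩
        by_cases hxl : Γ.Inc x l
        · exact Or.inr ⟨⟨hxl, fun e => hzY (e ▸ hz)⟩, hz, fun e => hzY (e ▸ a.base)⟩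
        exfalso
        have hfix : ∀ {W w}, Γ.Inc x W → Γ.Inc w W → w ≠ x → g • w = w → W = Y := by
          intro W w hW hw hwx hgw
          by_contra hWY
          exact hgS (h.mem_symm_of_mem_lineFixer hy hW a.base hWY
            (h.mem_lineFixer hW hw hwx hgw) hgY)
        by_cases hxz : Γ.Collinear x z
        · obtain ⟨W, hW, hzW⟩ := hxz
          have hzx : z ≠ x := fun e => hxl (e ▸ hz)
          have hWl : W ≠ l := fun e => hxl (e ▸ hW)
          have hgz' := h.quad.point_unique hWl (h.smul_mem_line g hW hzW) hgz hzW hz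
          exact hzY (hfix hW hzW hzx hgz' ▸ hzW)
        -- A flag with point not collinear with `x` would make `g` fix its line and the foot of that
        -- line, which must be on `Y`. Moving the point back to `y` by `c⁻¹` turns the line into
        -- `M`, so a conjugate of `g` would stabilize `M`.
        · obtain ⟨c, rfl⟩ := h.exists_smul_eq hy hxz
          obtain ⟨w, W, hW, hwW, hwl⟩ := h.quad.exists_proj hxl
          have hwx : w ≠ x := fun e => hxl (e ▸ hwl)
          have hgzW : ¬ Γ.Inc (g • c • y) W := fun e =>
            h.not_collinear_smul g hxz ⟨W, hW, e⟩
          have e := h.quad.proj_unique hgzW (h.inc_smul g hz) (h.inc_smul g hwl)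
            (h.smul_mem_line g hW hwW) hgz hwl hwW
          obtain rfl := hfix hW hwW hwx e.1
          have hyc : ¬ Γ.Inc y W := fun e => hy ⟨W, hW, e⟩
          have h1 := h.inc_smul c⁻¹ hz
          rw [inv_smul_smul] at h1
          have h2 := (h.quad.proj_unique hyc h1 (h.inc_smul c⁻¹ hwl)
            (h.smul_mem_line c⁻¹ hW hwW) a.tip a.right a.left).2
          refine hno c ?_
          rw [MulAction.mem_stabilizer_iff, ← h2, mul_smul, mul_smul, smul_inv_smul, e.2]
      · rintro (⟨hzY, hz⟩ | ⟨⟨hxl, -⟩, hz, -⟩)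
        · exact ⟨hz, by rwa [smul_eq_of_mem_lineFixer hgY hzY]⟩
        · exact ⟨hz, h.smul_mem_line g hxl hz⟩
    rw [hset, Set.ncard_union_eq, Set.ncard_image_of_injective _ Prod.swap_injective,
      Set.ncard_sigma_eq_mul _ _ (t + 1) fun z _ => h.order.2 z,
      Set.ncard_sigma_eq_mul (Γ.linesOn x \ {Y}) (fun l => Γ.pointsOn l \ {x}) s, h.order.1,
      Set.ncard_sdiff_singleton_of_mem (s := Γ.linesOn x) a.base, h.order.2,
      Nat.add_sub_cancel]
    · rintro l ⟨hl, -⟩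
      rw [Set.ncard_sdiff_singleton_of_mem (s := Γ.pointsOn l) hl, h.order.1, Nat.add_sub_cancel]
    · rw [Set.disjoint_left]
      rintro _ ⟨hzY, -⟩ ⟨⟨l, z⟩, ⟨⟨hl, hlY⟩, hz, hzx⟩, rfl⟩
      exact hlY (h.quad.line_unique hzx hz hl hzY a.base)
  have : Nonempty P := ⟨x⟩
  have hb := benson h.quad h.order (by have := h.two_le_s; omega) (MulAction.toPerm g)
    (MulAction.toPerm g) (fun p l => ⟨fun e => by
      simpa using h.inc_smul g⁻¹ e, fun e => h.inc_smul g e⟩)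
  simp only [MulAction.toPerm_apply] at hb
  have e := Nat.card_coe_set_eq {zl : P × L | Γ.Inc zl.1 zl.2 ∧ Γ.Inc (g • zl.1) zl.2}
  rw [hcard] at e
  change Nat.card {zl : P × L // Γ.Inc zl.1 zl.2 ∧ Γ.Inc (g • zl.1) zl.2} = _ at e
  rw [e] at hb
  -- The term `(s + 1) * (t + 1)` cancels, so the congruence says exactly that `s + t ∣ s * t`.
  apply h.not_dvd hy
  zify
  convert hb using 1
  push_cast
  ring

/-- Let `σ` in `S` have order `q`. At least `t` elements of `A_M` have order dividing `p`, but `σ`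
has at most `t - 1` conjugates, so some nontrivial one of them, `c`, commutes with `σ`. As `c * σ`
is conjugate to `c`, its `p`-th power is trivial, whence `σ ^ p = 1` and `q = p`. -/
lemma eq_of_prime_dvd [Finite G] [Finite P] [Finite L] (h : IsSkewAction Γ x G s t)
    (hy : ¬ Γ.Collinear x y) {p q : ℕ} (hp : p.Prime) (hq : q.Prime) (hps : p ∣ s)
    (hqt : q ∣ t) : q = p := by
  by_contra hqp
  obtain ⟨Y, hY⟩ := h.exists_line
  obtain ⟨u, M, a⟩ := h.exists_arm hy hY
  have hS := h.symm_normal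
  have := Fact.mk hq
  obtain ⟨⟨σ, hσ⟩, hσq⟩ := exists_prime_orderOf_dvd_card' (G := symm Γ x G) q
    (by rwa [h.card_symm hy])
  rw [Subgroup.orderOf_mk] at hσq
  have hσ1 : σ ≠ 1 := by
    rintro rfl
    rw [orderOf_one] at hσq
    exact hq.one_lt.ne hσq
  have h1 : ((symm Γ x G : Set G) \ {1}).ncard = t - 1 := by
    rw [Set.ncard_sdiff_singleton_of_mem (one_mem (symm Γ x G)), ← h.card_symm hy]
    rfl
  have h2 := h.le_card_torsion hy a hp hps
  have h3 : Nat.card (h.torsion hy a p) ≤ t - 1 := by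
    rw [← h1, ← Nat.card_coe_set_eq]
    refine Nat.card_le_card_of_injective
      (fun k => ⟨(k : G) * σ * (k : G)⁻¹, hS.conj_mem σ hσ k, ?_⟩) ?_
    · rw [Set.mem_singleton_iff, conj_eq_one_iff]
      exact hσ1
    · intro k m hkm
      have e : (k : G) * σ * (k : G)⁻¹ = m * σ * (m : G)⁻¹ := congrArg Subtype.val hkm
      by_contra hne
      set c : G := (m : G)⁻¹ * k with hc
      have hcT : c ∈ h.torsion hy a p := mul_mem (inv_mem m.2) k.2
      have hc1 : c ≠ 1 := fun e => hne (Subtype.ext (inv_mul_eq_one.1 e).symm)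
      have hcσ : Commute c σ := by
        have : c * σ * c⁻¹ = σ := by
          have h4 : c * σ * c⁻¹ = (m : G)⁻¹ * (k * σ * (k : G)⁻¹) * m := by rw [hc]; group
          rw [h4, e]; group
        exact mul_inv_eq_iff_eq_mul.1 this
      obtain ⟨d, hd⟩ := h.exists_conj_eq hy a hcT.1 hc1 hσ
      have h5 : (c * σ) ^ p = 1 := by rw [← hd, conj_pow, hcT.2, mul_one, mul_inv_cancel]
      rw [hcσ.mul_pow, hcT.2, one_mul] at h5
      have h6 := orderOf_dvd_of_pow_eq_one h5
      rw [hσq] at h6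
      exact hqp ((Nat.prime_dvd_prime_iff_eq hq hp).1 h6)
  have := h.two_le_t
  omega

lemma isNilpotent [Finite G] [Finite P] [Finite L] (h : IsSkewAction Γ x G s t)
    (hy : ¬ Γ.Collinear x y) : Group.IsNilpotent G := by
  have hs := h.two_le_s
  have ht := h.two_le_t
  obtain ⟨q, hq, hqt⟩ := Nat.exists_prime_and_dvd (n := t) (by omega)
  have hqs : ∀ {p}, p.Prime → p ∣ s → p = q := fun hp hps =>
    (h.eq_of_prime_dvd hy hp hq hps hqt).symm
  obtain ⟨p, hp, hps⟩ := Nat.exists_prime_and_dvd (n := s) (by omega)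
  obtain rfl := hqs hp hps
  have := Fact.mk hp
  have hcard : Nat.card G = p ^ (Nat.card G).primeFactorsList.length := by
    refine Nat.eq_prime_pow_of_unique_prime_dvd Nat.card_pos.ne' fun {d} hd hdG => ?_
    rw [h.card_eq hy, hd.dvd_mul, hd.dvd_mul] at hdG
    rcases hdG with h1 | h1 | h1
    · exact hqs hd h1
    · exact hqs hd h1
    · exact h.eq_of_prime_dvd hy hp hd hps h1
  exact (IsPGroup.of_card hcard).isNilpotent

/-- The symmetries in `G` are central. -/
theorem symm_le_center [Finite G] [Finite P] [Finite L] (h : IsSkewAction Γ x G s t)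
    (hy : ¬ Γ.Collinear x y) : symm Γ x G ≤ Subgroup.center G := by
  have hS := h.symm_normal
  have := h.isNilpotent hy
  obtain ⟨Y₀, hY₀⟩ := h.exists_line
  obtain ⟨u₀, M₀, a₀⟩ := h.exists_arm hy hY₀
  have : Nonempty {M // Γ.Inc y M} := ⟨⟨M₀, a₀.tip⟩⟩
  refine Subgroup.le_center_of_forall_exists_commutator
    (fun M : {M // Γ.Inc y M} => MulAction.stabilizer G (M : L)) (symm Γ x G) ?_ ?_ ?_ ?_ ?_ ?_
  · rw [commutator_def, Subgroup.commutator_le]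
    exact fun g _ k _ => h.commutator_mem_symm hy g k
  · rintro ⟨M, hM⟩ g hg k hk
    obtain ⟨Y, u, a⟩ := h.exists_arm' hy hM
    exact h.stabilizer_mul_comm hy a g hg k hk
  · rintro ⟨M, hM⟩
    obtain ⟨Y, u, a⟩ := h.exists_arm' hy hM
    rw [h.card_symm hy, h.card_stabilizer hy a]
    exact h.le hy
  · rintro ⟨M, hM⟩ g hg hgS
    obtain ⟨Y, u, a⟩ := h.exists_arm' hy hM
    exact h.eq_one_of_mem_stabilizer_of_mem_symm hy a hg hgS
  · intro H hSH hAH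
    obtain ⟨Z, hZY, hZ⟩ := h.quad.exists_line_ne Y₀ x
    obtain ⟨v, N, b⟩ := h.exists_arm hy hZ
    rw [eq_top_iff]
    intro g _
    obtain ⟨k, hk, hkg⟩ := h.exists_stabilizer_mul hy a₀ hZ hZY.symm g
    obtain ⟨m, hm, hmg⟩ := h.exists_stabilizer_mul_symm hy b hkg
    have h1 := mul_mem (hAH ⟨M₀, a₀.tip⟩ hk) (mul_mem (hAH ⟨N, b.tip⟩ hm) (hSH hmg))
    rwa [mul_inv_cancel_left, mul_inv_cancel_left] at h1
  · rintro ⟨M, hM⟩ g hg hg1 τ hτ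
    obtain ⟨Y, u, a⟩ := h.exists_arm' hy hM
    -- Since `⁅g, c⁆ = g * (c * g * c⁻¹)⁻¹`, the commutator is `τ` as soon as `c * g * c⁻¹ = τ⁻¹ *
    -- g`, which is `g` times this conjugate of `τ⁻¹`.
    obtain ⟨c, hc⟩ := h.exists_conj_eq hy a hg hg1 (σ := g⁻¹ * τ⁻¹ * g) (by
      simpa using hS.conj_mem τ⁻¹ (inv_mem hτ) g⁻¹)
    refine ⟨c, ?_⟩
    have h1 : (c * g * c⁻¹)⁻¹ = g⁻¹ * τ := by rw [hc]; group
    calc ⁅g, c⁆ = g * (c * g * c⁻¹)⁻¹ := by rw [commutatorElement_def]; group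
      _ = τ := by rw [h1, mul_inv_cancel_left]

end PointLineGeometry.IsSkewAction

/-! ### Rigidity of symmetries, apartments, and passage from `E` to the abstract action -/

namespace PointLineGeometry
variable {P L : Type*} {Γ : PointLineGeometry P L}

namespace IsElationAction
variable {x y : P} {G : Type*} [Group G] [MulAction G P] [MulAction G L] {s t : ℕ}
  {Y Z M N : L} {u v : P}

lemma exists_arm_of_inc (h : IsElationAction Γ x G s t) (hY : Γ.Inc x Y) (hu : Γ.Inc u Y)
    (hux : u ≠ x) : ∃ y M, ¬ Γ.Collinear x y ∧ Γ.IsArm x y Y u M := by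
  obtain ⟨M, hMY, hM⟩ := h.quad.exists_line_ne Y u
  obtain ⟨y, hyu, hy⟩ := h.quad.exists_point_ne u M
  have hxM : ¬ Γ.Inc x M := fun e => hMY (h.quad.line_unique hux hM e hu hY)
  refine ⟨y, M, ?_, hY, hu, hM, hy⟩
  rintro ⟨W, h1, h2⟩
  exact hyu (h.quad.proj_unique hxM h1 h2 hy hY hu hM).1

/-- Property (*): an element of `G` which fixes a second point of a line on `x` fixes all its
points, provided that the stabilizer of one such point is normal. -/
lemma smul_eq_of_smul_eq [Finite L] (h : IsElationAction Γ x G s t) (hY : Γ.Inc x Y) (hu : Γ.Inc u Y)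
    (hux : u ≠ x) (hnorm : ∀ g : G, g • u = u → ∀ k : G, (k * g * k⁻¹) • u = u) {g : G}
    {z w : P} (hz : Γ.Inc z Y) (hzx : z ≠ x) (hg : g • z = z) (hw : Γ.Inc w Y) :
    g • w = w := by
  -- Transitivity on the points of `Y` other than `x` makes their stabilizers conjugate, hence equal
  -- because one is normal.
  have key : ∀ {v}, Γ.Inc v Y → v ≠ x → ∃ k : G, k • u = v := by
    intro v hv hvx
    obtain ⟨y, M, hy, a⟩ := h.exists_arm_of_inc hY hu hux
    obtain ⟨y', M', hy', a'⟩ := h.exists_arm_of_inc hY hv hvx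
    obtain ⟨k, rfl⟩ := h.exists_smul_eq hy hy'
    exact ⟨k, (h.smul_arm hy a a'.tip a'.right a'.left).1⟩
  obtain ⟨k, rfl⟩ := key hz hzx
  have h1 : (k⁻¹ * g * k) • u = u := by
    rw [mul_smul, mul_smul, hg, inv_smul_smul]
  by_cases hwx : w = x
  · rw [hwx, h.smul_base]
  obtain ⟨m, rfl⟩ := key hw hwx
  have h2 := hnorm _ h1 (m⁻¹ * k)
  have h3 : m⁻¹ * k * (k⁻¹ * g * k) * (m⁻¹ * k)⁻¹ = m⁻¹ * g * m := by group
  rw [h3, mul_smul, mul_smul, inv_smul_eq_iff] at h2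
  exact h2

section Rigid
variable {σ : P → P} {τ : L → L}

/-- The line `M` is preserved since two of its points, `y` and its foot, are fixed. A point `z` of
`M` is then fixed as the projection on `M` of a fixed point of another line on `x`. -/
lemma apply_eq_of_collinear (h : IsElationAction Γ x G s t) [Finite L]
    (hστ : ∀ {p l}, Γ.Inc p l → Γ.Inc (σ p) (τ l)) (hfix : ∀ {z}, Γ.Collinear x z → σ z = z)
    (hy : ¬ Γ.Collinear x y) (hσy : σ y = y) {z : P} (hyM : Γ.Inc y M) (hzM : Γ.Inc z M) :
    σ z = z := by
  obtain ⟨Y, u, a⟩ := h.exists_arm' hy hyM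
  by_cases hzu : z = u
  · exact hfix ⟨Y, a.base, hzu ▸ a.left⟩
  have hz := not_collinear_of_arm h.quad hy a hzM hzu
  obtain ⟨Z, hZ, hZY, -⟩ := h.exists_line_ne_ne Y Y
  obtain ⟨w, K, b⟩ := h.exists_arm hz hZ
  have hτM : τ M = M := by
    have h1 := hστ hyM
    have h2 := hστ a.right
    rw [hσy] at h1
    rw [hfix ⟨Y, a.base, a.left⟩] at h2
    exact h.quad.line_unique (a.tip_ne hy) h1 h2 hyM a.right
  have h1 := hστ b.right
  rw [hfix ⟨Z, hZ, b.left⟩] at h1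
  have h2 := hστ hzM
  rw [hτM] at h2
  exact (h.quad.proj_unique (not_inc_arm h.quad hy a hZ hZY.symm b.left) h1 (hστ b.tip) h2
    b.right b.tip hzM).1

/-- The projection of `y` on `N` is not the foot of `N`, so it is not collinear with `x`, and the
fixed point `y` reaches `z` through it in two collinear steps. -/
lemma apply_eq_of_not_collinear (h : IsElationAction Γ x G s t) [Finite L]
    (hστ : ∀ {p l}, Γ.Inc p l → Γ.Inc (σ p) (τ l)) (hfix : ∀ {z}, Γ.Collinear x z → σ z = z)
    (hy : ¬ Γ.Collinear x y) (hσy : σ y = y) {z : P} (hz : ¬ Γ.Collinear x z)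
    (hzN : Γ.Inc z N) (hvN : Γ.Inc v N) (hxv : Γ.Collinear x v) (hyv : ¬ Γ.Collinear y v) :
    σ z = z := by
  obtain ⟨w, K, h1, h2, h3⟩ := h.quad.exists_proj (p := y) (l := N) fun e => hyv ⟨N, e, hvN⟩
  obtain ⟨Y, u, a⟩ := h.exists_arm' hz hzN
  have hvu : v = u := by
    by_contra hvu
    exact not_collinear_of_arm h.quad hz a hvN hvu hxv
  have hw : ¬ Γ.Collinear x w := by
    refine not_collinear_of_arm h.quad hz a h3 ?_
    rintro rfl
    exact hyv ⟨K, h1, hvu ▸ h2⟩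
  exact h.apply_eq_of_collinear hστ hfix hw
    (h.apply_eq_of_collinear hστ hfix hy hσy h1 h2) h3 hzN

/-- A symmetry with center `x` which fixes a point not collinear with `x` fixes all points. -/
lemma apply_eq (h : IsElationAction Γ x G s t) [Finite P] [Finite L]
    (hστ : ∀ {p l}, Γ.Inc p l → Γ.Inc (σ p) (τ l)) (hfix : ∀ {z}, Γ.Collinear x z → σ z = z)
    (hy : ¬ Γ.Collinear x y) (hσy : σ y = y) (z : P) : σ z = z := by
  by_cases hz : Γ.Collinear x z
  · exact hfix hz
  by_cases hex : ∃ N v, Γ.Inc z N ∧ Γ.Inc v N ∧ Γ.Collinear x v ∧ ¬ Γ.Collinear y v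
  · obtain ⟨N, v, h1, h2, h3, h4⟩ := hex
    exact h.apply_eq_of_not_collinear hστ hfix hy hσy hz h1 h2 h3 h4
  -- In the remaining case every foot of `z` is collinear with `y`. A third point of `M`, available
  -- because `s ≥ 2`, is fixed as well and is not collinear with the foot of `z` on `Z`, so it can
  -- replace `y`.
  push Not at hex
  obtain ⟨Y, hY⟩ := h.exists_line
  obtain ⟨u, M, a⟩ := h.exists_arm hy hY
  obtain ⟨Z, hZ, hZY, -⟩ := h.exists_line_ne_ne Y Y
  obtain ⟨v, N, b⟩ := h.exists_arm hz hZ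
  have hs := h.two_le_s
  obtain ⟨z', hz'M, hz'⟩ := Set.exists_mem_notMem_of_ncard_lt_ncard
    (s := {u, y}) (t := Γ.pointsOn M) ((Set.ncard_insert_le _ _).trans_lt (by
      rw [h.order.1, Set.ncard_singleton]; omega))
  simp only [Set.mem_insert_iff, Set.mem_singleton_iff, not_or] at hz'
  refine h.apply_eq_of_not_collinear hστ hfix (not_collinear_of_arm h.quad hy a hz'M hz'.1)
    (h.apply_eq_of_collinear hστ hfix hy hσy a.tip hz'M) hz b.tip b.right ⟨Z, hZ, b.left⟩ ?_
  rintro ⟨K, h1, h2⟩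
  obtain ⟨K', h3, h4⟩ := hex N v b.tip b.right ⟨Z, hZ, b.left⟩
  exact hz'.2 (h.quad.proj_unique (not_inc_arm h.quad hy a hZ hZY.symm b.left) h2 h1 hz'M
    h4 h3 a.tip).1

end Rigid
end IsElationAction

namespace IsSkewAction
variable {x y : P} {G : Type*} [Group G] [MulAction G P] [MulAction G L] {s t : ℕ}
  {Y Z M N : L} {u v : P}

/-- Transitivity on the apartments containing a root. -/
lemma exists_fixing_smul_eq [Finite G] [Finite P] [Finite L] (h : IsSkewAction Γ x G s t)
    {a b c c' : L} {q r r' z z' : P} (hxa : Γ.Inc x a) (hxM : Γ.Inc x M) (hqM : Γ.Inc q M)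
    (hqb : Γ.Inc q b) (hbM : b ≠ M) (hxq : x ≠ q)
    (hr : Γ.Inc r a) (hz : Γ.Inc z b) (hzq : z ≠ q) (hrc : Γ.Inc r c) (hzc : Γ.Inc z c)
    (hr' : Γ.Inc r' a) (hz' : Γ.Inc z' b) (hzq' : z' ≠ q) (hrc' : Γ.Inc r' c')
    (hzc' : Γ.Inc z' c') :
    ∃ g : G, (∀ l, Γ.Inc x l → g • l = l) ∧ (∀ l, Γ.Inc q l → g • l = l) ∧
      (∀ p, Γ.Inc p M → g • p = p) ∧ g • r = r' ∧ g • z = z' ∧ g • c = c' := by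
  have hxb : ¬ Γ.Inc x b := fun e => hbM (h.quad.line_unique hxq e hqb hxM hqM)
  have hxz : ¬ Γ.Collinear x z := by
    rintro ⟨W, h1, h2⟩
    exact hzq (h.quad.proj_unique hxb h1 h2 hz hxM hqM hqb).1
  have A : Γ.IsArm x z M q b := ⟨hxM, hqM, hqb, hz⟩
  have B : Γ.IsArm x z a r c := ⟨hxa, hr, hrc, hzc⟩
  obtain ⟨g, hg, rfl⟩ := h.exists_stabilizer_smul_eq hxz A hz' hzq'
  have hgM := h.stabilizer_le_lineFixer hxz A hg
  have hgB := h.smul_arm hxz B hzc' hrc' hr'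
  refine ⟨g, fun l hl => h.smul_line g hl, fun l hl => ?_,
    fun p hp => smul_eq_of_mem_lineFixer hgM hp, hgB.1, rfl, hgB.2⟩
  by_cases hlM : l = M
  · rw [hlM, h.smul_line g hxM]
  -- The line is a translate of `b` by a symmetry; as this symmetry commutes with `g` and `g` fixes
  -- `b`, the line is fixed.
  · obtain ⟨σ, hσ, rfl⟩ := h.exists_symm_smul_line_eq hxz A hl hlM
    rw [← mul_smul, Subgroup.mem_center_iff.1 (h.symm_le_center hxz hσ) g, mul_smul,
      MulAction.mem_stabilizer_iff.1 hg]

end IsSkewAction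

/-- Normal form for the apartments containing a root. -/
lemma IsApartment.exists_eq (h : Γ.IsQuad) {A : Set (P ⊕ L)} (hA : Γ.IsApartment A) {a b M : L}
    {x q : P} (hxa : Γ.Inc x a) (hxM : Γ.Inc x M) (hqM : Γ.Inc q M) (hqb : Γ.Inc q b)
    (haM : a ≠ M) (hbM : b ≠ M) (hxq : x ≠ q) (hsub : rootElements a x M q b ⊆ A) :
    ∃ r z c, Γ.Inc r a ∧ Γ.Inc z b ∧ z ≠ q ∧ Γ.Inc r c ∧ Γ.Inc z c ∧
      A = {Sum.inl x, Sum.inl q, Sum.inl r, Sum.inl z, Sum.inr a, Sum.inr M, Sum.inr b,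
        Sum.inr c} := by
  obtain ⟨p, l, ⟨hp, hl, hinc⟩, rfl⟩ := hA
  have ha : Sum.inr a ∈ gonElements p l := hsub (by simp [rootElements])
  have hx : Sum.inl x ∈ gonElements p l := hsub (by simp [rootElements])
  have hM : Sum.inr M ∈ gonElements p l := hsub (by simp [rootElements])
  have hq : Sum.inl q ∈ gonElements p l := hsub (by simp [rootElements])
  have hb : Sum.inr b ∈ gonElements p l := hsub (by simp [rootElements])
  simp only [gonElements, Set.mem_union, Set.mem_range, Sum.inl.injEq, reduceCtorEq,
    exists_false, or_false, Sum.inr.injEq, false_or] at ha hx hM hq hb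
  have e4 : ∀ i : Fin 4, i + 3 + 1 = i := by decide
  have e3 : ∀ i : Fin 4, i + 2 + 1 = i + 3 := by decide
  have e2 : ∀ i : Fin 4, i + 1 + 1 = i + 2 := by decide
  have i3 : ∀ i, Γ.Inc (p i) (l (i + 3)) := fun i => by simpa only [e4] using (hinc (i + 3)).2
  have key : ∀ i j, Γ.Inc (p i) (l j) → j = i ∨ j = i + 3 := by
    intro i j hij
    have hj : ∀ i j : Fin 4, j = i ∨ j = i + 1 ∨ j = i + 2 ∨ j = i + 3 := by decide
    have n1 : ∀ i : Fin 4, i ≠ i + 1 := by decide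
    have n2 : ∀ i : Fin 4, i ≠ i + 3 := by decide
    rcases hj i j with rfl | rfl | rfl | rfl
    · exact Or.inl rfl
    · exact absurd (hl (h.line_unique (hp.ne (n1 i)) (hinc i).1 (hinc i).2 hij (hinc _).1)) (n1 i)
    · have := (hinc (i + 2)).2
      rw [e3] at this
      exact absurd (hl (h.line_unique (hp.ne (n2 i)) (i3 i) (hinc _).1 hij this))
        (by clear * -; revert i; decide)
    · exact Or.inr rfl
  obtain ⟨i, rfl⟩ := hx
  obtain ⟨k, rfl⟩ := hq
  obtain ⟨ja, rfl⟩ := ha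
  obtain ⟨jM, rfl⟩ := hM
  obtain ⟨jb, rfl⟩ := hb
  have hall : ∀ i j : Fin 4, j = i ∨ j = i + 1 ∨ j = i + 2 ∨ j = i + 3 := by decide
  have hset : ∀ i, gonElements p l = {Sum.inl (p i), Sum.inl (p (i + 1)), Sum.inl (p (i + 2)),
      Sum.inl (p (i + 3)), Sum.inr (l i), Sum.inr (l (i + 1)), Sum.inr (l (i + 2)),
      Sum.inr (l (i + 3))} := by
    intro i
    ext w
    constructor
    · rintro (⟨j, rfl⟩ | ⟨j, rfl⟩) <;> rcases hall i j with rfl | rfl | rfl | rfl <;> simp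
    · rintro (rfl | rfl | rfl | rfl | rfl | rfl | rfl | rfl)
      all_goals first
        | exact Or.inl ⟨_, rfl⟩
        | exact Or.inr ⟨_, rfl⟩
  have haM' : ja ≠ jM := fun e => haM (congrArg l e)
  have hbM' : jb ≠ jM := fun e => hbM (congrArg l e)
  have hik : i ≠ k := fun e => hxq (congrArg p e)
  have k1 := key _ _ hxa
  have k2 := key _ _ hxM
  have k3 := key _ _ hqM
  have k4 := key _ _ hqb
  have hidx : (ja = i + 3 ∧ jM = i ∧ k = i + 1 ∧ jb = i + 1) ∨
      (ja = i ∧ jM = i + 3 ∧ k = i + 3 ∧ jb = i + 2) := by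
    have hk : ∀ i k : Fin 4, i ≠ k → i = k + 3 → k = i + 1 := by decide
    have hk' : ∀ i k : Fin 4, i + 3 = k + 3 → i = k := by decide
    have hb : ∀ i j : Fin 4, j ≠ i → j = i + 1 + 3 → False := by decide
    have hb' : ∀ j : Fin 4, j + 3 + 3 = j + 2 := by decide
    rcases k1 with rfl | rfl
    · obtain rfl := k2.resolve_left (Ne.symm haM')
      obtain rfl := k3.resolve_right fun e => hik (hk' _ _ e)
      exact Or.inr ⟨rfl, rfl, rfl, (k4.resolve_left hbM').trans (hb' _)⟩
    · obtain rfl := k2.resolve_right (Ne.symm haM')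
      obtain rfl := hk _ _ hik (k3.resolve_left hik)
      exact Or.inl ⟨rfl, rfl, rfl, k4.resolve_right fun e => hb _ _ hbM' e⟩
  rcases hidx with ⟨rfl, rfl, rfl, rfl⟩ | ⟨rfl, rfl, rfl, rfl⟩
  · have i1 := (hinc (jM + 1)).2
    have i2 := (hinc (jM + 2)).2
    rw [e2] at i1
    rw [e3] at i2
    refine ⟨p (jM + 3), p (jM + 2), l (jM + 2), (hinc _).1, i1,
      hp.ne (by clear * -; revert jM; decide), i2, (hinc _).1, ?_⟩
    rw [hset jM]
    ext w
    constructor <;> rintro (rfl | rfl | rfl | rfl | rfl | rfl | rfl | rfl) <;> simp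
  · have i1 := (hinc (ja + 1)).2
    rw [e2] at i1
    refine ⟨p (ja + 1), p (ja + 2), l (ja + 1), (hinc _).2, (hinc _).1,
      hp.ne (by clear * -; revert ja; decide), (hinc _).1, i1, ?_⟩
    rw [hset ja]
    ext w
    constructor <;> rintro (rfl | rfl | rfl | rfl | rfl | rfl | rfl | rfl) <;> simp

/-- The action on points of a group of automorphisms. -/
@[reducible] def pointAction (E : Subgroup (Equiv.Perm P × Equiv.Perm L)) : MulAction E P where
  smul g p := (g : Equiv.Perm P × Equiv.Perm L).1 p
  one_smul _ := rfl
  mul_smul _ _ _ := rfl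

/-- The action on lines of a group of automorphisms. -/
@[reducible] def lineAction (E : Subgroup (Equiv.Perm P × Equiv.Perm L)) : MulAction E L where
  smul g l := (g : Equiv.Perm P × Equiv.Perm L).2 l
  one_smul _ := rfl
  mul_smul _ _ _ := rfl

lemma ncard_perp_pair_le [Finite L] (h : Γ.IsQuad) {u v : P} (huv : ¬ Γ.Collinear u v) :
    (Γ.perp {u, v}).ncard ≤ (Γ.linesOn u).ncard := by
  rw [← Nat.card_coe_set_eq, ← Nat.card_coe_set_eq]
  have hu : ∀ z : Γ.perp {u, v}, Γ.Collinear z u := fun z => z.2 u (by simp)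
  have hv : ∀ z : Γ.perp {u, v}, Γ.Collinear z v := fun z => z.2 v (by simp)
  refine Nat.card_le_card_of_injective (fun z => ⟨(hu z).choose, (hu z).choose_spec.2⟩) ?_
  intro z w hzw
  have e : (hu z).choose = (hu w).choose := congrArg Subtype.val hzw
  have h1 := (hu z).choose_spec
  have h2 := (hu w).choose_spec
  rw [← e] at h2
  obtain ⟨m, h3, h4⟩ := hv z
  obtain ⟨n, h5, h6⟩ := hv w
  exact Subtype.ext (h.proj_unique (fun e => huv ⟨_, h1.2, e⟩) h4 h3 h1.1 h6 h5 h2.1).1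

/-- In a span of a regular point, two points of the trace determine the trace. -/
lemma IsRegularPoint.collinear [Finite P] [Finite L] (h : Γ.IsQuad) {s t : ℕ}
    (ho : Γ.HasOrder s t) {x : P}
    (hx : Γ.IsRegularPoint x) {y z u v w : P} (hy : ¬ Γ.Collinear x y) (huv : u ≠ v)
    (hux : Γ.Collinear u x) (huy : Γ.Collinear u y) (hvx : Γ.Collinear v x)
    (hvy : Γ.Collinear v y) (hzu : Γ.Collinear z u) (hzv : Γ.Collinear z v)
    (hwx : Γ.Collinear w x) (hwy : Γ.Collinear w y) : Γ.Collinear z w := by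
  have huv' : ¬ Γ.Collinear u v := by
    rintro ⟨l, hul, hvl⟩
    have key : ∀ p, Γ.Collinear u p → Γ.Collinear v p → Γ.Inc p l := by
      rintro p ⟨m, h1, h2⟩ ⟨n, h3, h4⟩
      by_contra hpl
      exact huv (h.proj_unique hpl h2 h1 hul h4 h3 hvl).1
    exact hy ⟨l, key x hux hvx, key y huy hvy⟩
  -- The span has `t + 1` points by regularity, and the trace of two non-collinear points has at
  -- most `t + 1`, so the inclusion is an equality.
  have hsub : Γ.perp (Γ.perp {x, y}) ⊆ Γ.perp {u, v} := by
    intro z hz c hc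
    refine hz c ?_
    rintro d (rfl | rfl) <;> rcases hc with rfl | rfl <;> assumption
  have heq := Set.eq_of_subset_of_ncard_le hsub (by
    rw [hx y hy, ho.2, ← ho.2 u]
    exact ncard_perp_pair_le h huv')
  have hz : z ∈ Γ.perp {u, v} := by rintro c (rfl | rfl) <;> assumption
  rw [← heq] at hz
  refine hz w ?_
  rintro d (rfl | rfl) <;> assumption

lemma IsSTGQ.exists_isSkewAction [Finite P] [Finite L] {x : P}
    {E : Subgroup (Equiv.Perm P × Equiv.Perm L)} (hΓ : Γ.IsSTGQ x E) (hstar : Γ.HasStar x E)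
    (hord : ∀ t : ℕ, Even t → ¬ Γ.HasOrder t t) :
    letI := pointAction E
    letI := lineAction E
    ∃ s t, IsSkewAction Γ x E s t := by
  let _ := pointAction E
  let _ := lineAction E
  obtain ⟨s, t, hs, ht, ho⟩ := hΓ.isGQ.exists_hasOrder
  have hE := hΓ.isElationGroup
  have h : IsElationAction Γ x E s t :=
    { quad := hΓ.isGQ.isQuad
      two_le_s := hs
      two_le_t := ht
      order := ho
      inc_smul := fun g p l hpl => (hE.le_autGroup g.2 p l).2 hpl
      smul_line := fun g l hl => hE.fixes_lines g g.2 l hl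
      exists_smul_eq := fun hy hz => by
        obtain ⟨g, ⟨hg, hgy⟩, -⟩ := hE.sharply_transitive _ _ hy hz
        exact ⟨⟨g, hg⟩, hgy⟩
      eq_one := fun {y g} hy hg =>
        Subtype.ext ((hE.sharply_transitive y y hy hy).unique ⟨g.2, hg⟩ ⟨one_mem E, rfl⟩) }
  refine ⟨s, t, h, ?_, ?_, ?_⟩
  · rintro rfl he
    exact hord s he ho
  · intro g Y z w hY hz hzx hg hw
    obtain ⟨u, hu, hux, hn⟩ := hstar Y hY
    exact h.smul_eq_of_smul_eq hY hu hux (fun k hk m => hn.conj_mem k hk m) hz hzx hg hw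
  · exact fun hy huv h1 h2 h3 h4 h5 h6 h7 h8 =>
      hΓ.isRegularPoint.collinear h.quad ho hy huv h1 h2 h3 h4 h5 h6 h7 h8

end PointLineGeometry

namespace PointLineGeometry
variable {P L : Type*} {Γ : PointLineGeometry P L}

/-- Every symmetry with center `x` is an elation. -/
lemma IsSTGQ.exists_mem_symm_of_mem_symmetryGroup [Finite P] [Finite L] {x : P}
    {E : Subgroup (Equiv.Perm P × Equiv.Perm L)} (hΓ : Γ.IsSTGQ x E) (hstar : Γ.HasStar x E)
    (hord : ∀ t : ℕ, Even t → ¬ Γ.HasOrder t t) {y : P} (hy : ¬ Γ.Collinear x y)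
    {γ : Equiv.Perm P × Equiv.Perm L} (hγ : γ ∈ Γ.symmetryGroup x) :
    letI := pointAction E
    ∃ g ∈ IsSkewAction.symm Γ x E, (g : Equiv.Perm P × Equiv.Perm L) = γ := by
  let _ := pointAction E
  let _ := lineAction E
  obtain ⟨s, t, h⟩ := hΓ.exists_isSkewAction hstar hord
  obtain ⟨hγ1, hγ2⟩ := hγ
  have hγi : ∀ {p l}, Γ.Inc p l → Γ.Inc (γ.1 p) (γ.2 l) := fun {p l} e => (hγ1 p l).2 e
  have hγy : ¬ Γ.Collinear x (γ.1 y) := by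
    intro e
    have := γ.1.injective (hγ2 _ e)
    exact hy (this ▸ e)
  -- The elation agreeing with `γ` at `y` fixes the same feet as `γ`, hence by (*) all points
  -- collinear with `x`. Then `g⁻¹` times `γ` is a symmetry fixing `y`, and rigidity makes it
  -- trivial.
  obtain ⟨g, hg⟩ := h.exists_smul_eq hy hγy
  have hgS : g ∈ IsSkewAction.symm Γ x E := by
    refine (mem_fixingSubgroup_iff E).2 ?_
    rintro z ⟨W, hW, hzW⟩
    obtain ⟨w, N, c⟩ := h.exists_arm hy hW
    have h1 := hγi c.tip
    have h2 := hγi c.right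
    rw [← hg] at h1
    rw [hγ2 w ⟨W, hW, c.left⟩] at h2
    exact h.star hW c.left (c.ne hy) (h.smul_arm hy c h1 h2 c.left).1 hzW
  refine ⟨g, hgS, ?_⟩
  have hP : ∀ z, g⁻¹ • γ.1 z = z := by
    refine h.apply_eq (σ := fun z => g⁻¹ • γ.1 z) (τ := fun l => g⁻¹ • γ.2 l)
      (fun e => h.inc_smul g⁻¹ (hγi e)) (fun {z} hz => ?_) hy ?_
    · rw [hγ2 z hz]
      exact (mem_fixingSubgroup_iff E).1 (inv_mem hgS) z hz
    · rw [← hg, inv_smul_smul]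
  have hP' : ∀ z, γ.1 z = g • z := fun z => by rw [← inv_smul_eq_iff, hP]
  have hL : ∀ l, γ.2 l = g • l := by
    intro l
    obtain ⟨p, -, hp⟩ := h.quad.exists_point_ne x l
    obtain ⟨q, hqp, hq⟩ := h.quad.exists_point_ne p l
    have h1 := hγi hp
    have h2 := hγi hq
    rw [hP'] at h1 h2
    exact h.quad.line_unique (fun e => hqp (MulAction.injective g e).symm) h1 h2
      (h.inc_smul g hp) (h.inc_smul g hq)
  exact Prod.ext (Equiv.ext fun z => (hP' z).symm) (Equiv.ext fun l => (hL l).symm)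

/-- The elations act transitively on the apartments containing a root with `x` in its interior. -/
lemma IsSTGQ.exists_image_eq [Finite P] [Finite L] {x : P}
    {E : Subgroup (Equiv.Perm P × Equiv.Perm L)} (hΓ : Γ.IsSTGQ x E) (hstar : Γ.HasStar x E)
    (hord : ∀ t : ℕ, Even t → ¬ Γ.HasOrder t t) {a b M : L} {q : P} (hxa : Γ.Inc x a)
    (hxM : Γ.Inc x M) (hqM : Γ.Inc q M) (hqb : Γ.Inc q b) (haM : a ≠ M) (hbM : b ≠ M)
    (hxq : x ≠ q) {A A' : Set (P ⊕ L)} (hA : Γ.IsApartment A) (hA' : Γ.IsApartment A')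
    (hsub : rootElements a x M q b ⊆ A) (hsub' : rootElements a x M q b ⊆ A') :
    ∃ g ∈ E, (∀ l, Γ.Inc x l → g.2 l = l) ∧ (∀ l, Γ.Inc q l → g.2 l = l) ∧
      (∀ z, Γ.Inc z M → g.1 z = z) ∧ Sum.map g.1 g.2 '' A = A' := by
  let _ := pointAction E
  let _ := lineAction E
  obtain ⟨s, t, h⟩ := hΓ.exists_isSkewAction hstar hord
  obtain ⟨r, z, c, h1, h2, h3, h4, h5, rfl⟩ :=
    hA.exists_eq h.quad hxa hxM hqM hqb haM hbM hxq hsub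
  obtain ⟨r', z', c', h1', h2', h3', h4', h5', rfl⟩ :=
    hA'.exists_eq h.quad hxa hxM hqM hqb haM hbM hxq hsub'
  obtain ⟨⟨g, hg⟩, g1, g2, g3, g4, g5, g6⟩ := h.exists_fixing_smul_eq hxa hxM hqM hqb hbM hxq
    h1 h2 h3 h4 h5 h1' h2' h3' h4' h5'
  change ∀ l, Γ.Inc x l → g.2 l = l at g1
  change ∀ l, Γ.Inc q l → g.2 l = l at g2
  change ∀ p, Γ.Inc p M → g.1 p = p at g3
  change g.1 r = r' at g4
  change g.1 z = z' at g5
  change g.2 c = c' at g6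
  refine ⟨g, hg, g1, g2, g3, ?_⟩
  simp only [Set.image_insert_eq, Set.image_singleton, Sum.map_inl, Sum.map_inr, g3 x hxM,
    g3 q hqM, g4, g5, g6, g1 a hxa, g1 M hxM, g2 b hqb]

end PointLineGeometry

theorem mainTheorem4 {P L : Type*} [Finite P] [Finite L] (Γ : PointLineGeometry P L) (x : P)
    (E : Subgroup (Equiv.Perm P × Equiv.Perm L)) (hΓ : Γ.IsSTGQ x E) (hstar : Γ.HasStar x E)
    (hord : ∀ t : ℕ, Even t → ¬ Γ.HasOrder t t) :
    Γ.HasCentrality x E ∧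
      ∀ (p : P) (M : L) (q : P), Γ.IsIRoot p M q → (x = p ∨ x = q) →
        Γ.IsMoufangIRoot p M q := by
  refine ⟨?_, ?_⟩
  · intro γ hγ
    obtain ⟨p, l, hg⟩ := hΓ.isGQ.exists_five_gon
    obtain ⟨i, hi⟩ := hΓ.isGQ.isQuad.exists_not_collinear_of_five_gon hg x
    let _ := PointLineGeometry.pointAction E
    let _ := PointLineGeometry.lineAction E
    obtain ⟨s, t, h⟩ := hΓ.exists_isSkewAction hstar hord
    obtain ⟨g, hgS, rfl⟩ := hΓ.exists_mem_symm_of_mem_symmetryGroup hstar hord hi hγ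
    exact ⟨g, h.symm_le_center hi hgS, rfl⟩
  · rintro p M q - hx a b ⟨⟨haM, hMb, hab, hpq⟩, ⟨h1, h2, h3, h4⟩, -⟩ A A' hA hA' hsub hsub'
    rcases hx with rfl | rfl
    · obtain ⟨g, hg, g1, g2, g3, hgA⟩ := hΓ.exists_image_eq hstar hord h1 h2 h3 h4 haM hMb.symm
        hpq hA hA' hsub hsub'
      refine ⟨g, ⟨hΓ.isElationGroup.le_autGroup hg, ?_, ?_⟩, hgA⟩
      · rintro z (hz | hz | hz)
        · cases hz; exact g1
        · cases hz
        · cases hz; exact g2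
      · rintro l (hl | hl | hl)
        · cases hl
        · cases hl; exact g3
        · cases hl
    -- When `x` is the second point of the i-root, the root is read backwards.
    · have hrev : PointLineGeometry.rootElements b x M p a =
          PointLineGeometry.rootElements a p M x b := by
        ext w
        simp only [PointLineGeometry.rootElements, Set.mem_insert_iff, Set.mem_singleton_iff]
        tauto
      obtain ⟨g, hg, g1, g2, g3, hgA⟩ := hΓ.exists_image_eq hstar hord h4 h3 h2 h1 hMb.symm haM
        hpq.symm hA hA' (hrev ▸ hsub) (hrev ▸ hsub')
      refine ⟨g, ⟨hΓ.isElationGroup.le_autGroup hg, ?_, ?_⟩, hgA⟩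
      · rintro z (hz | hz | hz)
        · cases hz; exact g2
        · cases hz
        · cases hz; exact g1
      · rintro l (hl | hl | hl)
        · cases hl
        · cases hl; exact g3
        · cases hl
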